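/- Let $M$ be a matroid on the ground set $[n]=\{1,\dots,n\}$ with set of bases $\mathcal B_M$, and let $\mathbf p=(p_1,\dots,p_n)$ be a point of its base polytope $\mathcal P_M=\operatorname{conv}\{\mathbf 1_B : B\in\mathcal B_M\}\subset\mathbb R^n$. Let $\mu$ be the uniform distribution on $\mathcal B_M$, regarded as a probability distribution on the subsets of $[n]$. Terminology. For a probability distribution $\nu:2^{[n]}\to\mathbb R_{\ge 0}$ let $g_\nu(z_1,\dots,z_n)=\sum_{S\subseteq[n]}\nu(S)\prod_{i\in S}z_i$ be its generating polynomial, $\nu_i=\sum_{S\ni i}\nu(S)$ its $i$-th marginal, and $\nu^*(S)=\nu([n]\setminus S)$ its dual. For $\lambda\in\mathbb R_{>0}^n$, the $\lambda$-external field applied to $\nu$ is the probability distribution assigning to each $S$ a probability proportional to $\bigl(\prod_{i\in S}\lambda_i\bigr)\nu(S)$. A polynomial $g\in\mathbb R[z_1,\dots,z_n]$ is completely log-concave if for every $k\ge 0$ and every nonnegative matrix $V\in\mathbb R_{\ge 0}^{n\times k}$ the polynomial $D_Vg=\bigl(\prod_{j=1}^k\sum_{i=1}^nV_{ij}\partial_i\bigr)g$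 is nonnegative and log-concave on $\mathbb R_{>0}^n$, that is, $D_Vg$ is either identically zero, or positive on $\mathbb R_{>0}^n$ with $\log (D_Vg)$ concave there. A distribution $\nu$ is completely log-concave if $g_\nu$ is. Then there is a probability distribution $\tilde\mu:2^{[n]}\to\mathbb R_{\ge0}$ whose support is contained in $\mathcal B_M$, with marginals $\tilde\mu_i=p_i$ for all $i\in[n]$, such that both $\tilde\mu$ and $\tilde\mu^*$ are completely log-concave. Furthermore, $\tilde\mu$ is the limit of a sequence of distributions, each obtained by applying an external field with weights in $\mathbb R_{>0}^n$ to $\mu$, and likewise $\tilde\mu^*$ is the limit of a sequence of distributions, each obtained by applying an external field with weights in $\mathbb R_{>0}^n$ to $\mu^*$. -/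

import Mathlib

noncomputable section

open scoped Classical in
/-- The indicator vector `𝟙_S` of a set `S`. -/
def indicatorVec {E : Type*} (S : Finset E) : E → ℝ := fun i => if i ∈ S then 1 else 0

/-- The base polytope of a matroid: the convex hull of the indicator vectors of its bases. -/
def basePolytope {E : Type*} (M : Matroid E) : Set (E → ℝ) :=
  convexHull ℝ {x | ∃ B : Finset E, M.IsBase (B : Set E) ∧ x = indicatorVec B}

/-- The open positive orthant. -/
def posOrthant (E : Type*) : Set (E → ℝ) := {z | ∀ i, 0 < z i}

/-- The differential operator `∂_v = ∑ i, v i ∂_i`. -/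
def dirDeriv {E : Type*} [Fintype E] (v : E → ℝ) : Module.End ℝ (MvPolynomial E ℝ) :=
  ∑ i, v i • (MvPolynomial.pderiv i).toLinearMap

/-- The differential operator `D_V = ∏ j, ∑ i, V i j ∂_i`, the composition of the directional
derivatives along the columns of `V`. -/
def matDeriv {E : Type*} [Fintype E] {k : ℕ} (V : Matrix E (Fin k) ℝ) :
    Module.End ℝ (MvPolynomial E ℝ) :=
  (List.ofFn fun j => dirDeriv fun i => V i j).prod

/-- `g` is log-concave over the positive orthant: `log g` is a well-defined concave function
there. By convention the zero polynomial is log-concave. -/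
def IsLogConcave {E : Type*} (g : MvPolynomial E ℝ) : Prop :=
  g = 0 ∨ ((∀ z ∈ posOrthant E, 0 < MvPolynomial.eval z g) ∧
    ConcaveOn ℝ (posOrthant E) fun z => Real.log (MvPolynomial.eval z g))

/-- `g` is completely log-concave: for every `k ≥ 0` and every nonnegative `V`, the polynomial
`D_V g` is nonnegative and log-concave over the positive orthant. -/
def IsCompletelyLogConcave {E : Type*} [Fintype E] (g : MvPolynomial E ℝ) : Prop :=
  ∀ (k : ℕ) (V : Matrix E (Fin k) ℝ), (∀ i j, 0 ≤ V i j) →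
    (∀ z ∈ posOrthant E, 0 ≤ MvPolynomial.eval z (matDeriv V g)) ∧ IsLogConcave (matDeriv V g)

/-- `μ` is a probability distribution on the subsets of `E`. -/
def IsDistribution {E : Type*} [Fintype E] (μ : Finset E → ℝ) : Prop :=
  (∀ S, 0 ≤ μ S) ∧ ∑ S, μ S = 1

/-- The generating polynomial `∑ S, μ(S) ∏ i ∈ S, z_i`. -/
def genPoly {E : Type*} [Fintype E] (μ : Finset E → ℝ) : MvPolynomial E ℝ :=
  ∑ S, MvPolynomial.C (μ S) * ∏ i ∈ S, MvPolynomial.X i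

open scoped Classical in
/-- The marginal probability `μ_i = ∑_{S ∋ i} μ(S)`. -/
def marginal {E : Type*} [Fintype E] (μ : Finset E → ℝ) (i : E) : ℝ :=
  ∑ S with i ∈ S, μ S

open scoped Classical in
/-- The dual distribution `μ*(S) = μ(E \ S)`. -/
def dualDist {E : Type*} [Fintype E] (μ : Finset E → ℝ) : Finset E → ℝ := fun S => μ Sᶜ

/-- The `lam`-external field applied to `μ`: the probability of `S` is proportional to
`(∏ i ∈ S, lam i) * μ S`. -/
def extField {E : Type*} [Fintype E] (lam : E → ℝ) (μ : Finset E → ℝ) : Finset E → ℝ :=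
  fun S => ((∏ i ∈ S, lam i) * μ S) / ∑ T, (∏ i ∈ T, lam i) * μ T

open scoped Classical in
/-- The uniform distribution on the bases of a matroid. -/
def uniformBases {E : Type*} [Fintype E] (M : Matroid E) : Finset E → ℝ := fun S =>
  if M.IsBase (S : Set E) then 1 / (Finset.card {B : Finset E | M.IsBase (B : Set E)} : ℝ) else 0

/-- `ν` is a limit of external fields (with positive weights) applied to `μ`. -/
def IsLimitOfExtFields {E : Type*} [Fintype E] (ν μ : Finset E → ℝ) : Prop :=
  ∃ lam : ℕ → E → ℝ, (∀ m i, 0 < lam m i) ∧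
    Filter.Tendsto (fun m => extField (lam m) μ) Filter.atTop (nhds ν)

end

/-! Log-concavity comes from a pointwise inequality. Complete log-concavity of a multiaffine `g`
with nonnegative coefficients follows once every iterated derivative `h` of `g` along nonnegative
directions satisfies `h · ∂_u² h ≤ (∂_u h)²` on the positive orthant for every real `u`
(`HessianBound`). Both sides are quadratic in the coefficients, so this survives scalar multiples
and limits; it also survives external fields, which only substitute `z ↦ lam * z`. It therefore
suffices to prove it for the bases of a matroid. The dual side is the same statement for `M✶`,
because complementation turns the field `lam` into `lam⁻¹`.

For a matroid the core is `alexandrov_fenchel_baseInd`, by induction on the number of directions. In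
rank two the nonloops form a complete multipartite graph on the parallel classes, whose quadratic
form has at most one positive square. In higher rank the partial derivatives are contractions, and
`reverse_cauchy_schwarz_of_slices` passes from them to a positive combination. That step is
spectral: the inequalities for the slices force every positive eigenvalue of a normalized matrix to
be 1, and connectivity of the graph of independent pairs makes that eigenvalue simple. Euler's
identity converts the result into the Hessian inequality (`hessianBound_baseInd`).

The marginals come from entropy duality. Minimizing the log-partition function minus `⟨y, p⟩`, with
a small quadratic penalty, gives an external field whose marginals are close to `p` even when `p`
lies on the boundary of the polytope. Compactness of the simplex then yields the limit
(`IsDistribution.exists_limit_with_marginals`). -/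

noncomputable section

open scoped Classical

/-! ### Multiaffine polynomials through their coefficients, and the Hessian criterion. -/

section Multiaffine

variable {E : Type*}

theorem pderiv_prod_X (i : E) (S : Finset E) :
    MvPolynomial.pderiv (R := ℝ) i (∏ j ∈ S, MvPolynomial.X j) =
      if i ∈ S then ∏ j ∈ S.erase i, MvPolynomial.X j else 0 := by
  induction S using Finset.induction_on with
  | empty => simp
  | insert a S ha ih =>
    rw [Finset.prod_insert ha, MvPolynomial.pderiv_mul, ih, MvPolynomial.pderiv_X]
    by_cases hia : i = a
    · subst hia
      simp [ha]
    · have : a ∉ S.erase i := fun h => ha (Finset.mem_of_mem_erase h)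
      rw [Finset.erase_insert_of_ne (Ne.symm hia)]
      by_cases hi : i ∈ S
      · simp [hi, hia, Finset.prod_insert this, Ne.symm hia]
      · simp [hi, hia, Ne.symm hia]

variable [Fintype E]

/-- The action of the directional derivative `∂_v` on coefficients of multiaffine polynomials. -/
def lnk (v : E → ℝ) (ν : Finset E → ℝ) : Finset E → ℝ :=
  fun S => ∑ i, if i ∈ S then 0 else v i * ν (insert i S)

/-- The value of the generating polynomial of `ν` at `z`. -/
def evalGen (z : E → ℝ) (ν : Finset E → ℝ) : ℝ := ∑ S, ν S * ∏ i ∈ S, z i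

theorem eval_genPoly (z : E → ℝ) (ν : Finset E → ℝ) :
    MvPolynomial.eval z (genPoly ν) = evalGen z ν := by
  simp [genPoly, evalGen, map_sum, map_prod]

theorem sum_ite_mem_eq_sum_insert {A : Type*} [AddCommMonoid A] (i : E) (f : Finset E → A) :
    ∑ S, (if i ∈ S then f S else 0) = ∑ S, if i ∈ S then 0 else f (insert i S) := by
  have h : ∀ S : Finset E, (if i ∈ S then 0 else f (insert i S)) =
      if i ∉ S then f (insert i S) else 0 := fun S => by split_ifs <;> simp_all
  simp_rw [h]
  rw [← Finset.sum_filter, ← Finset.sum_filter]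
  refine Finset.sum_nbij' (fun S => S.erase i) (fun S => insert i S) ?_ ?_ ?_ ?_ ?_ <;>
    simp +contextual [Finset.insert_erase]

theorem dirDeriv_genPoly (v : E → ℝ) (ν : Finset E → ℝ) :
    dirDeriv v (genPoly ν) = genPoly (lnk v ν) := by
  have h1 : ∀ i : E, v i • MvPolynomial.pderiv i (genPoly ν) =
      ∑ S, if i ∈ S then 0 else
        MvPolynomial.C (v i * ν (insert i S)) * ∏ j ∈ S, MvPolynomial.X j := by
    intro i
    have : v i • MvPolynomial.pderiv i (genPoly ν) = ∑ S : Finset E, if i ∈ S then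
        MvPolynomial.C (v i * ν S) * ∏ j ∈ S.erase i, MvPolynomial.X j else 0 := by
      rw [genPoly, map_sum, Finset.smul_sum]
      refine Finset.sum_congr rfl fun S _ => ?_
      rw [MvPolynomial.pderiv_C_mul, pderiv_prod_X, MvPolynomial.smul_eq_C_mul]
      split_ifs
      · rw [map_mul, mul_assoc]
      · simp
    rw [this, sum_ite_mem_eq_sum_insert]
    refine Finset.sum_congr rfl fun S _ => ?_
    split_ifs with h
    · rfl
    · rw [Finset.erase_insert h]
  simp only [dirDeriv, LinearMap.sum_apply, LinearMap.smul_apply, Derivation.coeFn_coe, h1]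
  rw [Finset.sum_comm, genPoly]
  refine Finset.sum_congr rfl fun S _ => ?_
  rw [lnk, map_sum, Finset.sum_mul]
  refine Finset.sum_congr rfl fun i _ => ?_
  split_ifs <;> simp

theorem prod_map_dirDeriv_genPoly (L : List (E → ℝ)) (ν : Finset E → ℝ) :
    (L.map dirDeriv).prod (genPoly ν) = genPoly (L.foldr lnk ν) := by
  induction L with
  | nil => simp
  | cons v L ih => simp [Module.End.mul_apply, ih, dirDeriv_genPoly]

theorem matDeriv_genPoly {k : ℕ} (V : Matrix E (Fin k) ℝ) (ν : Finset E → ℝ) :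
    matDeriv V (genPoly ν) = genPoly ((List.ofFn fun j i => V i j).foldr lnk ν) := by
  rw [← prod_map_dirDeriv_genPoly, matDeriv, List.map_ofFn]
  rfl

theorem lnk_comm (u v : E → ℝ) (ν : Finset E → ℝ) :
    lnk u (lnk v ν) = lnk v (lnk u ν) := by
  funext S
  have h : ∀ u v : E → ℝ, lnk u (lnk v ν) S = ∑ i, ∑ j, if i ∈ S ∨ j ∈ S ∨ i = j then 0 else
      u i * v j * ν (insert i (insert j S)) := by
    intro u v
    refine Finset.sum_congr rfl fun i _ => ?_
    split_ifs with hi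
    · simp [hi]
    · rw [lnk, Finset.mul_sum]
      refine Finset.sum_congr rfl fun j _ => ?_
      by_cases hij : i = j
      · simp [hij]
      · simp only [Finset.mem_insert, hi, hij, Ne.symm hij, false_or, or_false]
        split_ifs
        · simp
        · rw [Finset.insert_comm]; ring
  rw [h, h, Finset.sum_comm]
  refine Finset.sum_congr rfl fun i _ => Finset.sum_congr rfl fun j _ => ?_
  rw [Finset.insert_comm]
  by_cases hij : i = j
  · simp [hij]
  · simp only [hij, Ne.symm hij, or_false]
    simp only [or_comm (a := j ∈ S)]
    split_ifs <;> ring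

/-- Directional derivatives commute, so a new direction can be applied first; inductions on the list
then act on the original measure, for instance by contracting the matroid. -/
theorem lnk_foldr (v : E → ℝ) (L : List (E → ℝ)) (ν : Finset E → ℝ) :
    lnk v (L.foldr lnk ν) = L.foldr lnk (lnk v ν) := by
  induction L with
  | nil => rfl
  | cons u L ih => simp [lnk_comm v u, ih]

theorem lnk_nonneg {v : E → ℝ} {ν : Finset E → ℝ} (hv : ∀ i, 0 ≤ v i) (hν : ∀ S, 0 ≤ ν S)
    (S : Finset E) : 0 ≤ lnk v ν S :=
  Finset.sum_nonneg fun i _ => by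
    split_ifs
    · exact le_rfl
    · exact mul_nonneg (hv i) (hν _)

theorem foldr_lnk_nonneg {L : List (E → ℝ)} {ν : Finset E → ℝ} (hL : ∀ v ∈ L, ∀ i, 0 ≤ v i)
    (hν : ∀ S, 0 ≤ ν S) : ∀ S, 0 ≤ L.foldr lnk ν S := by
  induction L with
  | nil => exact hν
  | cons v L ih =>
    exact lnk_nonneg (hL v (by simp)) (ih fun u hu => hL u (by simp [hu]))

theorem lnk_zero (v : E → ℝ) : lnk v (0 : Finset E → ℝ) = 0 := by
  funext S
  simp [lnk]

theorem foldr_lnk_zero (L : List (E → ℝ)) : L.foldr lnk (0 : Finset E → ℝ) = 0 := by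
  induction L with
  | nil => rfl
  | cons v L ih => simp [ih, lnk_zero]

/-- The measure `ν` is supported on sets of cardinality `d`. -/
def IsHomog (d : ℕ) (ν : Finset E → ℝ) : Prop := ∀ S, ν S ≠ 0 → S.card = d

theorem IsHomog.lnk {d : ℕ} {ν : Finset E → ℝ} (h : IsHomog (d + 1) ν) (v : E → ℝ) :
    IsHomog d (lnk v ν) := by
  intro S hS
  obtain ⟨i, -, hi⟩ := Finset.exists_ne_zero_of_sum_ne_zero hS
  split_ifs at hi with hiS
  · exact absurd rfl hi
  · have := h _ (right_ne_zero_of_mul hi)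
    rw [Finset.card_insert_of_notMem hiS] at this
    omega

theorem IsHomog.lnk_eq_zero {ν : Finset E → ℝ} (h : IsHomog 0 ν) (v : E → ℝ) :
    _root_.lnk v ν = 0 := by
  funext S
  by_contra hS
  obtain ⟨i, -, hi⟩ := Finset.exists_ne_zero_of_sum_ne_zero hS
  split_ifs at hi with hiS
  · exact absurd rfl hi
  · have := h _ (right_ne_zero_of_mul hi)
    simp at this

theorem IsHomog.foldr_lnk {ν : Finset E → ℝ} (L : List (E → ℝ)) (m : ℕ)
    (h : IsHomog (L.length + m) ν) : IsHomog m (L.foldr _root_.lnk ν) := by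
  induction L generalizing m with
  | nil => simpa using h
  | cons v L ih =>
    refine IsHomog.lnk (ih (m + 1) ?_) v
    rw [List.length_cons] at h
    convert h using 1
    omega

theorem IsHomog.foldr_lnk_eq_zero {ν : Finset E → ℝ} (L : List (E → ℝ)) {d : ℕ}
    (h : IsHomog d ν) (hd : d < L.length) : L.foldr _root_.lnk ν = 0 := by
  induction L generalizing d ν with
  | nil => simp at hd
  | cons v L ih =>
    rw [List.foldr_cons, lnk_foldr]
    cases d with
    | zero => rw [h.lnk_eq_zero, foldr_lnk_zero]
    | succ d => exact ih (h.lnk v) (by simpa using hd)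

theorem evalGen_lnk (z v : E → ℝ) (ν : Finset E → ℝ) :
    evalGen z (lnk v ν) = ∑ S, ∑ i, if i ∈ S then v i * ν S * ∏ j ∈ S.erase i, z j else 0 := by
  rw [Finset.sum_comm]
  simp_rw [sum_ite_mem_eq_sum_insert]
  rw [Finset.sum_comm, evalGen]
  refine Finset.sum_congr rfl fun S _ => ?_
  rw [lnk, Finset.sum_mul]
  refine Finset.sum_congr rfl fun i _ => ?_
  split_ifs with h
  · simp
  · rw [Finset.erase_insert h]

/-- Euler's identity. -/
theorem IsHomog.evalGen_lnk_self {d : ℕ} {ν : Finset E → ℝ} (h : IsHomog d ν) (z : E → ℝ) :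
    evalGen z (_root_.lnk z ν) = d * evalGen z ν := by
  rw [evalGen_lnk, evalGen, Finset.mul_sum]
  refine Finset.sum_congr rfl fun S _ => ?_
  rw [← Finset.sum_filter]
  have : ∀ i ∈ Finset.univ.filter (· ∈ S), z i * ν S * ∏ j ∈ S.erase i, z j =
      ν S * ∏ j ∈ S, z j := fun i hi => by
    rw [← Finset.mul_prod_erase S z (by simpa using hi)]
    ring
  rw [Finset.sum_congr rfl this, Finset.sum_const]
  by_cases hS : ν S = 0
  · simp [hS]
  · simp [h S hS]

/-- Iterating Euler's identity trades evaluation at `z` for `m` further derivatives along `z`, so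
statements about constant terms become statements about values. -/
theorem IsHomog.foldr_replicate {m : ℕ} {ν : Finset E → ℝ} (h : IsHomog m ν) (z : E → ℝ) :
    (List.replicate m z).foldr _root_.lnk ν ∅ = m.factorial * evalGen z ν := by
  induction m generalizing ν with
  | zero =>
    have : ∀ S ∈ Finset.univ, S ≠ (∅ : Finset E) → ν S * ∏ i ∈ S, z i = 0 := by
      intro S _ hS
      by_cases h0 : ν S = 0
      · simp [h0]
      · exact absurd (Finset.card_eq_zero.1 (h S h0)) hS
    simp [evalGen, Finset.sum_eq_single_of_mem (∅ : Finset E) (Finset.mem_univ _) this]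
  | succ m ih =>
    rw [List.replicate_succ, List.foldr_cons, lnk_foldr, ih (h.lnk z), h.evalGen_lnk_self,
      Nat.factorial_succ]
    push_cast
    ring

theorem evalGen_nonneg {z : E → ℝ} {ν : Finset E → ℝ} (hz : ∀ i, 0 < z i) (hν : ∀ S, 0 ≤ ν S) :
    0 ≤ evalGen z ν :=
  Finset.sum_nonneg fun S _ => mul_nonneg (hν S) (Finset.prod_nonneg fun i _ => (hz i).le)

theorem evalGen_pos {z : E → ℝ} {ν : Finset E → ℝ} (hz : ∀ i, 0 < z i) (hν : ∀ S, 0 ≤ ν S)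
    {S : Finset E} (hS : 0 < ν S) : 0 < evalGen z ν :=
  Finset.sum_pos' (fun S _ => mul_nonneg (hν S) (Finset.prod_nonneg fun i _ => (hz i).le))
    ⟨S, Finset.mem_univ _, mul_pos hS (Finset.prod_pos fun i _ => hz i)⟩

theorem hasDerivAt_evalGen (z u : E → ℝ) (ν : Finset E → ℝ) (t : ℝ) :
    HasDerivAt (fun t : ℝ => evalGen (fun i => z i + t * u i) ν)
      (evalGen (fun i => z i + t * u i) (lnk u ν)) t := by
  rw [evalGen_lnk]
  unfold evalGen
  refine HasDerivAt.fun_sum fun S _ => ?_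
  have h := HasDerivAt.fun_finsetProd (u := S) (f := fun i (t : ℝ) => z i + t * u i)
    (f' := u) (x := t) fun i _ => by
      simpa using ((hasDerivAt_id t).mul_const (u i)).const_add (z i)
  refine (h.const_mul (ν S)).congr_deriv ?_
  rw [← Finset.sum_filter, Finset.mul_sum]
  refine Finset.sum_congr (by ext; simp) fun i _ => ?_
  simp only [smul_eq_mul]
  ring

/-- Concavity is tested on segments, where `(log f)'' = (f'' f - f'²) / f²`. The direction `u` is a
difference of two points, so its entries may have any sign. -/
theorem concaveOn_log_evalGen {ν : Finset E → ℝ} (hpos : ∀ z ∈ posOrthant E, 0 < evalGen z ν)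
    (h : ∀ z : E → ℝ, (∀ i, 0 < z i) → ∀ u : E → ℝ,
      evalGen z ν * evalGen z (lnk u (lnk u ν)) ≤ evalGen z (lnk u ν) ^ 2) :
    ConcaveOn ℝ (posOrthant E) fun z => Real.log (evalGen z ν) := by
  have hconv : Convex ℝ (posOrthant E) := by
    intro x hx y hy a b ha hb hab i
    have h1 := hx i
    have h2 := hy i
    simp only [Pi.add_apply, Pi.smul_apply, smul_eq_mul]
    rcases ha.eq_or_lt with rfl | ha
    · have : b = 1 := by linarith
      subst this; simpa using h2
    · exact add_pos_of_pos_of_nonneg (mul_pos ha h1) (mul_nonneg hb h2.le)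
  refine ⟨hconv, fun x hx y hy a b ha hb hab => ?_⟩
  set u : E → ℝ := fun i => y i - x i with hu
  have hmem : ∀ t ∈ Set.Icc (0 : ℝ) 1, (fun i => x i + t * u i) ∈ posOrthant E := by
    intro t ht
    have := hconv hx hy (sub_nonneg.2 ht.2) ht.1 (by ring)
    convert this using 1
    funext i
    simp [hu]
    ring
  have hmem' : ∀ t ∈ interior (Set.Icc (0 : ℝ) 1), (fun i => x i + t * u i) ∈ posOrthant E :=
    fun t ht => hmem t (interior_subset ht)
  have key : ConcaveOn ℝ (Set.Icc (0 : ℝ) 1)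
      fun t => Real.log (evalGen (fun i => x i + t * u i) ν) := by
    refine concaveOn_of_hasDerivWithinAt2_nonpos (convex_Icc 0 1)
      (f' := fun t => evalGen (fun i => x i + t * u i) (lnk u ν) /
        evalGen (fun i => x i + t * u i) ν)
      (f'' := fun t => (evalGen (fun i => x i + t * u i) (lnk u (lnk u ν)) *
        evalGen (fun i => x i + t * u i) ν - evalGen (fun i => x i + t * u i) (lnk u ν) *
        evalGen (fun i => x i + t * u i) (lnk u ν)) / evalGen (fun i => x i + t * u i) ν ^ 2)
      ?_ ?_ ?_ ?_
    · intro t ht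
      exact ((hasDerivAt_evalGen x u ν t).log
        (hpos _ (hmem t ht)).ne').continuousAt.continuousWithinAt
    · intro t ht
      exact ((hasDerivAt_evalGen x u ν t).log (hpos _ (hmem' t ht)).ne').hasDerivWithinAt
    · intro t ht
      exact ((hasDerivAt_evalGen x u (lnk u ν) t).fun_div (hasDerivAt_evalGen x u ν t)
        (hpos _ (hmem' t ht)).ne').hasDerivWithinAt
    · intro t ht
      refine div_nonpos_of_nonpos_of_nonneg ?_ (sq_nonneg _)
      have := h _ (hmem' t ht) u
      nlinarith
  have := key.2 (Set.left_mem_Icc.2 zero_le_one) (Set.right_mem_Icc.2 zero_le_one) ha hb hab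
  convert this using 4
  · simp
  · simp [hu]
  · simp [hu]
    rw [← eq_sub_iff_add_eq] at hab
    subst hab
    ring

/-- The Hessian inequality expressing complete log-concavity of a multiaffine polynomial. -/
def HessianBound (ν : Finset E → ℝ) : Prop :=
  ∀ L : List (E → ℝ), (∀ v ∈ L, ∀ i, 0 ≤ v i) → ∀ z : E → ℝ, (∀ i, 0 < z i) → ∀ u : E → ℝ,
    evalGen z (L.foldr lnk ν) * evalGen z (lnk u (lnk u (L.foldr lnk ν))) ≤
      evalGen z (lnk u (L.foldr lnk ν)) ^ 2

theorem HessianBound.isCompletelyLogConcave {ν : Finset E → ℝ} (hν : ∀ S, 0 ≤ ν S)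
    (h : HessianBound ν) : IsCompletelyLogConcave (genPoly ν) := by
  intro k V hV
  rw [matDeriv_genPoly]
  have hL : ∀ v ∈ List.ofFn (fun j i => V i j), ∀ i, 0 ≤ v i := by
    intro v hv
    obtain ⟨j, rfl⟩ := (List.mem_ofFn' _ _).1 hv
    exact fun i => hV i j
  set η := (List.ofFn fun j i => V i j).foldr lnk ν with hη
  have hη0 : ∀ S, 0 ≤ η S := foldr_lnk_nonneg hL hν
  simp only [IsLogConcave, eval_genPoly]
  refine ⟨fun z hz => evalGen_nonneg hz hη0, ?_⟩
  by_cases h0 : ∀ S, η S = 0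
  · left
    simp [genPoly, h0]
  · right
    push Not at h0
    obtain ⟨S, hS⟩ := h0
    have hpos : ∀ z ∈ posOrthant E, 0 < evalGen z η := fun z hz =>
      evalGen_pos hz hη0 (lt_of_le_of_ne (hη0 S) (Ne.symm hS))
    exact ⟨hpos, concaveOn_log_evalGen hpos (h _ hL)⟩

end Multiaffine

/-! ### Symmetric matrices with at most one positive direction. -/

section Lorentzian

variable {ι : Type*} [Fintype ι]

open Matrix

/-- In an orthonormal eigenbasis, the vectors with positive eigenvalue are multiples of `u`, hence
orthogonal to `x`; only nonpositive terms remain. -/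
theorem Matrix.IsHermitian.dotProduct_mulVec_nonpos {S : Matrix ι ι ℝ} (hS : S.IsHermitian)
    {u : ι → ℝ} (h : ∀ (v : ι → ℝ) (a : ℝ), 0 < a → S *ᵥ v = a • v → ∃ c : ℝ, v = c • u)
    {x : ι → ℝ} (hx : x ⬝ᵥ u = 0) : x ⬝ᵥ S *ᵥ x ≤ 0 := by
  set b := hS.eigenvectorBasis
  have hsum : x = ∑ i, (x ⬝ᵥ (b i).ofLp) • (b i).ofLp := by
    have := congrArg WithLp.ofLp (b.sum_repr' (WithLp.toLp 2 x))
    rw [WithLp.ofLp_sum] at this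
    simpa [EuclideanSpace.inner_eq_star_dotProduct] using this.symm
  have hS' : S *ᵥ x = ∑ i, (x ⬝ᵥ (b i).ofLp) • hS.eigenvalues i • (b i).ofLp := by
    conv_lhs => rw [hsum, Matrix.mulVec_sum]
    refine Finset.sum_congr rfl fun i _ => ?_
    rw [Matrix.mulVec_smul, hS.mulVec_eigenvectorBasis]
  rw [hS', dotProduct_sum]
  refine Finset.sum_nonpos fun i _ => ?_
  rw [dotProduct_smul, dotProduct_smul, smul_eq_mul, smul_eq_mul]
  rcases le_or_gt (hS.eigenvalues i) 0 with h0 | h0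
  · nlinarith [mul_self_nonneg (x ⬝ᵥ (b i).ofLp)]
  · obtain ⟨c, hc⟩ := h _ _ h0 (hS.mulVec_eigenvectorBasis i)
    have : x ⬝ᵥ (b i).ofLp = 0 := by
      rw [hc, dotProduct_smul, hx, smul_zero]
    rw [this]; simp

/-- If `A ≤ A D A` in the sense of quadratic forms, where `D = diag (z i / (A z) i)`, then a
nonnegative irreducible symmetric matrix `A` is negative semidefinite on the orthogonal complement
of `A z`. -/
theorem dotProduct_mulVec_nonpos_of_irreducible {A : Matrix ι ι ℝ} (hA : A.IsHermitian)
    (hA0 : ∀ i j, 0 ≤ A i j) {z w : ι → ℝ} (hz : ∀ i, 0 < z i) (hw : A *ᵥ z = w)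
    (hB : ∀ x, x ⬝ᵥ A *ᵥ x ≤ ∑ i, z i / w i * (A *ᵥ x) i ^ 2)
    (hconn : ∀ c : ι → ℝ, (∀ i j, 0 < A i j → c i = c j) → ∀ i j, 0 < w i → 0 < w j → c i = c j)
    {x : ι → ℝ} (hx : x ⬝ᵥ w = 0) : x ⬝ᵥ A *ᵥ x ≤ 0 := by
  have hsym : ∀ i j, A i j = A j i := fun i j => by
    simpa using congrFun (congrFun hA j) i
  have hwi : ∀ i, w i = ∑ j, A i j * z j := fun i => by rw [← hw]; rfl
  have hw0 : ∀ i, 0 ≤ w i := fun i => by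
    rw [hwi]; exact Finset.sum_nonneg fun j _ => mul_nonneg (hA0 i j) (hz j).le
  have hwz : ∀ i, w i = 0 → ∀ j, A i j = 0 := fun i h j => by
    rw [hwi, Finset.sum_eq_zero_iff_of_nonneg
      fun j _ => mul_nonneg (hA0 i j) (hz j).le] at h
    exact (mul_eq_zero.1 (h j (Finset.mem_univ j))).resolve_right (hz j).ne'
  -- With `D = diag (z i / w i)`, pass to `S = D^(1/2) A D^(1/2)`, for which `u` is a fixed vector.
  -- Where `w i = 0`, division by zero gives `s i = 0`; the corresponding row of `A` vanishes, so
  -- nothing is lost.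
  set s : ι → ℝ := fun i => √(z i / w i) with hs
  set u : ι → ℝ := fun i => √(z i * w i) with hu
  set S : Matrix ι ι ℝ := fun i j => s i * A i j * s j with hSdef
  have hss : ∀ i, s i ^ 2 = z i / w i := fun i =>
    Real.sq_sqrt (div_nonneg (hz i).le (hw0 i))
  have hS : S.IsHermitian := by
    ext i j
    rw [Matrix.conjTranspose_apply, star_trivial]
    change s j * A j i * s i = s i * A i j * s j
    rw [hsym j i]
    ring
  have hSv : ∀ (v : ι → ℝ) i, (S *ᵥ v) i = s i * (A *ᵥ fun j => s j * v j) i := fun v i => by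
    simp only [mulVec, dotProduct, hSdef, Finset.mul_sum]
    exact Finset.sum_congr rfl fun j _ => by ring
  have hpar : ∀ (v : ι → ℝ) (a : ℝ), 0 < a → S *ᵥ v = a • v → ∃ c : ℝ, v = c • u := by
    intro v a ha hv
    set x : ι → ℝ := fun j => s j * v j with hxdef
    have hvi : ∀ i, s i * (A *ᵥ x) i = a * v i := fun i => by
      rw [← hSv, hv]; rfl
    have hv0 : ∀ i, w i = 0 → v i = 0 := fun i hi => by
      have := hvi i
      simp only [hs, hi, div_zero, Real.sqrt_zero, zero_mul] at this
      exact (mul_eq_zero.1 this.symm).resolve_left ha.ne'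
    set N := ∑ i, v i ^ 2 with hN
    have hN0 : 0 ≤ N := Finset.sum_nonneg fun i _ => sq_nonneg _
    have h1 : x ⬝ᵥ A *ᵥ x = a * N := by
      rw [hN, Finset.mul_sum]
      refine Finset.sum_congr rfl fun i _ => ?_
      rw [hxdef, mul_right_comm, ← hxdef, hvi]; ring
    have h2 : ∑ i, z i / w i * (A *ᵥ x) i ^ 2 = a ^ 2 * N := by
      rw [hN, Finset.mul_sum]
      refine Finset.sum_congr rfl fun i _ => ?_
      rw [← hss, ← mul_pow, hvi, mul_pow]
    have h3 : ∑ i, ∑ j, A i j * z j * (x i ^ 2 / z i) = N := by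
      refine Finset.sum_congr rfl fun i _ => ?_
      rw [← Finset.sum_mul, ← hwi, hxdef]
      simp only [mul_pow, hss]
      by_cases hi : w i = 0
      · simp [hi, hv0 i hi]
      · have := (hz i).ne'
        field_simp
    -- The Dirichlet form of the weighted graph `A i j * z i * z j`. Its nonnegativity bounds the
    -- eigenvalue by `a ≤ 1`, and equality forces `x / z` to be constant along edges.
    have h4 : ∑ i, ∑ j, A i j * (z i * z j) * (x i / z i - x j / z j) ^ 2 = 2 * (N - a * N) := by
      have e1 : ∑ i, ∑ j, A i j * (z i * z j) * (x i / z i - x j / z j) ^ 2 =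
          ∑ i, ∑ j, A i j * z j * (x i ^ 2 / z i) + ∑ i, ∑ j, A i j * z i * (x j ^ 2 / z j)
            - 2 * ∑ i, ∑ j, x i * (A i j * x j) := by
        simp only [Finset.mul_sum, ← Finset.sum_add_distrib, ← Finset.sum_sub_distrib]
        refine Finset.sum_congr rfl fun i _ => Finset.sum_congr rfl fun j _ => ?_
        have := (hz i).ne'
        have := (hz j).ne'
        field_simp
        ring
      have e2 : ∑ i, ∑ j, A i j * z i * (x j ^ 2 / z j) = N := by
        rw [Finset.sum_comm, ← h3]
        exact Finset.sum_congr rfl fun i _ => Finset.sum_congr rfl fun j _ => by rw [hsym]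
      have e3 : ∑ i, ∑ j, x i * (A i j * x j) = a * N := by
        rw [← h1]
        exact Finset.sum_congr rfl fun i _ => (Finset.mul_sum _ _ _).symm
      rw [e1, e2, e3, h3]; ring
    have h5 := hB x
    rw [h1, h2] at h5
    rcases hN0.eq_or_lt with hN1 | hN1
    · refine ⟨0, funext fun i => ?_⟩
      have := (Finset.sum_eq_zero_iff_of_nonneg fun i _ => sq_nonneg (v i)).1 hN1.symm i
        (Finset.mem_univ i)
      simpa using this
    -- The hypothesis `hB` reads `a N ≤ a² N` on this eigenvector.
    · have ha1 : 1 ≤ a := by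
        have : a * (a * N - N) ≥ 0 := by nlinarith
        have := nonneg_of_mul_nonneg_right this ha
        nlinarith
      have h6 : ∀ i j, 0 ≤ A i j * (z i * z j) * (x i / z i - x j / z j) ^ 2 := fun i j =>
        mul_nonneg (mul_nonneg (hA0 i j) (mul_pos (hz i) (hz j)).le) (sq_nonneg _)
      have h7 : ∑ i, ∑ j, A i j * (z i * z j) * (x i / z i - x j / z j) ^ 2 = 0 := by
        refine le_antisymm ?_ (Finset.sum_nonneg fun i _ => Finset.sum_nonneg fun j _ => h6 i j)
        rw [h4]; nlinarith
      have h8 : ∀ i j, 0 < A i j → x i / z i = x j / z j := fun i j hij => by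
        have e := (Finset.sum_eq_zero_iff_of_nonneg
          fun i _ => Finset.sum_nonneg fun j _ => h6 i j).1 h7 i (Finset.mem_univ i)
        have e := (Finset.sum_eq_zero_iff_of_nonneg fun j _ => h6 i j).1 e j (Finset.mem_univ j)
        have e := (mul_eq_zero.1 e).resolve_left (mul_pos hij (mul_pos (hz i) (hz j))).ne'
        exact sub_eq_zero.1 (pow_eq_zero_iff two_ne_zero |>.1 e)
      have h9 := hconn (fun i => x i / z i) h8
      have h10 : ∃ c, ∀ i, 0 < w i → x i / z i = c := by
        by_cases hex : ∃ i, 0 < w i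
        · obtain ⟨j, hj⟩ := hex
          exact ⟨_, fun i hi => h9 i j hi hj⟩
        · exact ⟨0, fun i hi => absurd ⟨i, hi⟩ hex⟩
      obtain ⟨c, hc⟩ := h10
      refine ⟨c, funext fun i => ?_⟩
      rcases (hw0 i).eq_or_lt with hi | hi
      · simp [hv0 i hi.symm, hu, ← hi]
      · have hsi : 0 < s i := Real.sqrt_pos.2 (div_pos (hz i) hi)
        have hsu : s i * u i = z i := by
          rw [hs, hu]
          simp only
          rw [← Real.sqrt_mul (div_pos (hz i) hi).le]
          have : z i / w i * (z i * w i) = z i ^ 2 := by field_simp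
          rw [this, Real.sqrt_sq (hz i).le]
        have := hc i hi
        rw [div_eq_iff (hz i).ne', ← hsu] at this
        refine mul_left_cancel₀ hsi.ne' ?_
        simp only [Pi.smul_apply, smul_eq_mul]
        change x i = _
        rw [this]; ring
  -- `r` inverts `s` where `w i > 0`; since `r i * u i = w i`, orthogonality to `w` becomes
  -- orthogonality to `u`.
  set r : ι → ℝ := fun i => √(w i / z i) with hr
  have hrs : ∀ i, 0 < w i → s i * r i = 1 := fun i hi => by
    rw [hs, hr]
    simp only
    rw [← Real.sqrt_mul (div_pos (hz i) hi).le]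
    have := (hz i).ne'
    have : z i / w i * (w i / z i) = 1 := by field_simp
    rw [this, Real.sqrt_one]
  have hru : ∀ i, r i * u i = w i := fun i => by
    rw [hr, hu]
    simp only
    rw [← Real.sqrt_mul (div_nonneg (hw0 i) (hz i).le)]
    have := (hz i).ne'
    have : w i / z i * (z i * w i) = w i ^ 2 := by field_simp
    rw [this, Real.sqrt_sq (hw0 i)]
  have := hS.dotProduct_mulVec_nonpos hpar (x := fun i => x i * r i) (by
    rw [← hx]
    exact Finset.sum_congr rfl fun i _ => by rw [mul_assoc, hru])
  convert this using 1
  simp only [dotProduct, mulVec, Finset.mul_sum, hSdef]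
  refine Finset.sum_congr rfl fun i _ => Finset.sum_congr rfl fun j _ => ?_
  rcases (hw0 i).eq_or_lt with hi | hi
  · simp [hwz i hi.symm]
  rcases (hw0 j).eq_or_lt with hj | hj
  · simp [hsym i j, hwz j hj.symm]
  have e1 := hrs i hi
  have e2 := hrs j hj
  calc x i * (A i j * x j) = x i * (A i j * x j) * (s i * r i) * (s j * r j) := by
        rw [e1, e2]; ring
    _ = _ := by ring

/-- A symmetric matrix that is negative semidefinite on the orthogonal complement of `A z`
satisfies the reverse Cauchy-Schwarz inequality. -/
theorem reverse_cauchy_schwarz {A : Matrix ι ι ℝ} (hA : A.IsHermitian) {z : ι → ℝ}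
    (h : ∀ x, x ⬝ᵥ A *ᵥ z = 0 → x ⬝ᵥ A *ᵥ x ≤ 0) (x : ι → ℝ) {y : ι → ℝ}
    (hy : y ⬝ᵥ A *ᵥ z ≠ 0) (hyy : 0 ≤ y ⬝ᵥ A *ᵥ y) :
    (x ⬝ᵥ A *ᵥ x) * (y ⬝ᵥ A *ᵥ y) ≤ (x ⬝ᵥ A *ᵥ y) ^ 2 := by
  have hsym : y ⬝ᵥ A *ᵥ x = x ⬝ᵥ A *ᵥ y := by
    have hA' : A.IsSymm := by simpa using hA
    rw [dotProduct_comm, dotProduct_mulVec, ← mulVec_transpose, hA'.eq]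
  by_contra! hlt
  have hxx : 0 < x ⬝ᵥ A *ᵥ x := by
    by_contra! h0
    nlinarith [sq_nonneg (x ⬝ᵥ A *ᵥ y), mul_nonneg (neg_nonneg.2 h0) hyy]
  set p := y ⬝ᵥ A *ᵥ z
  set q := x ⬝ᵥ A *ᵥ z
  -- The combination of `x` and `y` that is orthogonal to `A z`.
  have h1 := h (p • x - q • y) (by
    rw [sub_dotProduct, smul_dotProduct, smul_dotProduct, smul_eq_mul, smul_eq_mul, mul_comm,
      sub_self])
  rw [mulVec_sub, mulVec_smul, mulVec_smul] at h1
  simp only [sub_dotProduct, dotProduct_sub, smul_dotProduct, dotProduct_smul, smul_eq_mul,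
    hsym] at h1
  set a := x ⬝ᵥ A *ᵥ x
  set b := x ⬝ᵥ A *ᵥ y
  set d := y ⬝ᵥ A *ᵥ y
  -- Multiply by `a > 0` and complete the square; the assumed strict failure then forces `q = 0` and
  -- `p * a = 0`.
  have h2 : (p * a - q * b) ^ 2 + q ^ 2 * (a * d - b ^ 2) ≤ 0 := by
    have : (p * a - q * b) ^ 2 + q ^ 2 * (a * d - b ^ 2) =
        a * (p * (p * a) - q * (p * b) - (p * (q * b) - q * (q * d))) := by ring
    rw [this]
    exact mul_nonpos_of_nonneg_of_nonpos hxx.le (by linarith)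
  have h3 : 0 ≤ q ^ 2 * (a * d - b ^ 2) := mul_nonneg (sq_nonneg _) (by linarith)
  have hq : q = 0 := by
    have : q ^ 2 * (a * d - b ^ 2) = 0 := by nlinarith [sq_nonneg (p * a - q * b)]
    rcases mul_eq_zero.1 this with h | h
    · exact pow_eq_zero_iff two_ne_zero |>.1 h
    · linarith
  rw [hq] at h2
  have : 0 < (p * a) ^ 2 := by positivity
  nlinarith

/-- A positive combination of the slices of a nonnegative symmetric tensor whose slices satisfy
the reverse Cauchy-Schwarz inequality satisfies it as well, provided that it is irreducible. -/
theorem reverse_cauchy_schwarz_of_slices {T : ι → Matrix ι ι ℝ} (hT1 : ∀ i j k, T i j k = T j i k)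
    (hT2 : ∀ i j k, T i j k = T i k j) (hT0 : ∀ i j k, 0 ≤ T i j k) {z : ι → ℝ} (hz : ∀ i, 0 < z i)
    (hslice : ∀ i x, (x ⬝ᵥ T i *ᵥ x) * (z ⬝ᵥ T i *ᵥ z) ≤ (x ⬝ᵥ T i *ᵥ z) ^ 2)
    {A : Matrix ι ι ℝ} (hAT : ∀ j k, A j k = ∑ i, z i * T i j k)
    (hconn : ∀ c : ι → ℝ, (∀ i j, 0 < A i j → c i = c j) →
      ∀ i j, (∃ k, 0 < A i k) → (∃ k, 0 < A j k) → c i = c j)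
    (x : ι → ℝ) {y : ι → ℝ} (hy : ∀ i, 0 < y i) :
    (x ⬝ᵥ A *ᵥ x) * (y ⬝ᵥ A *ᵥ y) ≤ (x ⬝ᵥ A *ᵥ y) ^ 2 := by
  have hA : A.IsHermitian := by
    ext j k
    simp only [conjTranspose_apply, star_trivial, hAT]
    exact Finset.sum_congr rfl fun i _ => by rw [hT2]
  have hA0 : ∀ i j, 0 ≤ A i j := fun j k => by
    rw [hAT]; exact Finset.sum_nonneg fun i _ => mul_nonneg (hz i).le (hT0 i j k)
  have hTz : ∀ i j, (T i *ᵥ z) j = A i j := fun i j => by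
    rw [hAT]
    exact Finset.sum_congr rfl fun k _ => by
      change T i j k * z k = z k * T k i j
      rw [hT2 i j k, hT1 i k j, mul_comm]
  have hTz' : ∀ i, T i *ᵥ z = A i := fun i => funext (hTz i)
  have hxT : ∀ x i, x ⬝ᵥ T i *ᵥ z = (A *ᵥ x) i := fun x i => by
    rw [hTz', dotProduct_comm]; rfl
  have hw0 : ∀ i, 0 ≤ (A *ᵥ z) i := fun i =>
    Finset.sum_nonneg fun j _ => mul_nonneg (hA0 i j) (hz j).le
  have hwpos : ∀ i, 0 < (A *ᵥ z) i → ∃ k, 0 < A i k := by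
    intro i hi
    by_contra! h
    have : (A *ᵥ z) i = 0 := Finset.sum_eq_zero fun j _ => by
      simp [le_antisymm (h j) (hA0 i j)]
    linarith
  -- By symmetry of the tensor `T i *ᵥ z` is row `i` of `A`, so the slice inequality reads `(x ⬝ᵥ T
  -- i *ᵥ x) * (A *ᵥ z) i ≤ (A *ᵥ x) i ^ 2`. Divide and sum with weights `z i`.
  have hB : ∀ x, x ⬝ᵥ A *ᵥ x ≤ ∑ i, z i / (A *ᵥ z) i * (A *ᵥ x) i ^ 2 := by
    intro x
    have e : x ⬝ᵥ A *ᵥ x = ∑ i, z i * (x ⬝ᵥ T i *ᵥ x) := by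
      simp only [dotProduct, mulVec, hAT, Finset.mul_sum, Finset.sum_mul]
      conv_rhs => rw [Finset.sum_comm]
      refine Finset.sum_congr rfl fun j _ => ?_
      rw [Finset.sum_comm]
      exact Finset.sum_congr rfl fun i _ => Finset.sum_congr rfl fun k _ => by ring
    rw [e]
    refine Finset.sum_le_sum fun i _ => ?_
    have h := hslice i x
    rw [hxT, hxT] at h
    rw [div_mul_eq_mul_div, mul_div_assoc]
    refine mul_le_mul_of_nonneg_left ?_ (hz i).le
    rcases (hw0 i).eq_or_lt with hi | hi
    · rw [← hi, div_zero]
      have hAi : ∀ k, A i k = 0 := by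
        have h1 : ∑ j, A i j * z j = 0 := hi.symm
        rw [Finset.sum_eq_zero_iff_of_nonneg fun j _ => mul_nonneg (hA0 i j) (hz j).le] at h1
        exact fun j => (mul_eq_zero.1 (h1 j (Finset.mem_univ j))).resolve_right (hz j).ne'
      have hTi : ∀ j k, T i j k = 0 := by
        intro j k
        have h1 := hTz i j
        rw [hAi] at h1
        have h1 : ∑ k, T i j k * z k = 0 := h1
        rw [Finset.sum_eq_zero_iff_of_nonneg fun k _ => mul_nonneg (hT0 i j k) (hz k).le] at h1
        exact (mul_eq_zero.1 (h1 k (Finset.mem_univ k))).resolve_right (hz k).ne'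
      have : T i = 0 := by ext j k; exact hTi j k
      simp [this]
    · rwa [le_div_iff₀ hi]
  have hyA0 : ∀ v : ι → ℝ, (∀ i, 0 < v i) → 0 ≤ y ⬝ᵥ A *ᵥ v := fun v hv =>
    Finset.sum_nonneg fun i _ => mul_nonneg (hy i).le
      (Finset.sum_nonneg fun j _ => mul_nonneg (hA0 i j) (hv j).le)
  by_cases hyz : y ⬝ᵥ A *ᵥ z = 0
  · have hA1 : A = 0 := by
      have h1 : ∑ i, y i * (A *ᵥ z) i = 0 := hyz
      rw [Finset.sum_eq_zero_iff_of_nonneg fun j _ => mul_nonneg (hy j).le (hw0 j)] at h1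
      ext i k
      by_contra hne
      have h2 := (mul_eq_zero.1 (h1 i (Finset.mem_univ i))).resolve_left (hy i).ne'
      have h2 : ∑ j, A i j * z j = 0 := h2
      rw [Finset.sum_eq_zero_iff_of_nonneg fun j _ => mul_nonneg (hA0 i j) (hz j).le] at h2
      exact hne ((mul_eq_zero.1 (h2 k (Finset.mem_univ k))).resolve_right (hz k).ne')
    simp [hA1]
  · exact reverse_cauchy_schwarz hA (fun x hx =>
      dotProduct_mulVec_nonpos_of_irreducible hA hA0 hz rfl hB
        (fun c hc i j hi hj => hconn c hc i j (hwpos i hi) (hwpos j hj)) hx) x hyz (hyA0 y hy)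

end Lorentzian

/-! ### The reverse Cauchy-Schwarz inequality for matroid bases. -/

section MatroidBases

open Matrix

/-- Replacing `t` by its extreme value `√a * √b` leaves a difference equal to the square of `|p| *
√b - |r| * √a`. -/
theorem aczel_inequality {p r a b t : ℝ} (ha : a ≤ p ^ 2) (hb : b ≤ r ^ 2) (ha0 : 0 ≤ a)
    (hb0 : 0 ≤ b) (ht : t ^ 2 ≤ a * b) : (p ^ 2 - a) * (r ^ 2 - b) ≤ (p * r - t) ^ 2 := by
  have h1 : |t| ≤ √a * √b := by
    rw [← Real.sqrt_mul ha0]; exact Real.abs_le_sqrt ht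
  have h2 : √a ≤ |p| := by rw [← Real.sqrt_sq_eq_abs]; exact Real.sqrt_le_sqrt ha
  have h3 : √b ≤ |r| := by rw [← Real.sqrt_sq_eq_abs]; exact Real.sqrt_le_sqrt hb
  have h4 : √a * √b ≤ |p| * |r| := mul_le_mul h2 h3 (Real.sqrt_nonneg _) (abs_nonneg _)
  have h5 : |p| * |r| - √a * √b ≤ |p * r - t| := by
    have := abs_sub_abs_le_abs_sub (p * r) t
    rw [abs_mul] at this
    linarith
  have h6 := pow_le_pow_left₀ (sub_nonneg.2 h4) h5 2
  rw [sq_abs] at h6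
  refine le_trans ?_ h6
  rw [← sq_abs p, ← sq_abs r]
  nth_rewrite 1 [← Real.sq_sqrt ha0, ← Real.sq_sqrt hb0]
  nlinarith [sq_nonneg (|p| * √b - |r| * √a)]

/-- The form is the product of the total sums minus a sum over classes of products of class sums:
one positive square against negative squares. Aczél's inequality applies, its hypothesis on `t`
being the ordinary Cauchy-Schwarz inequality over the classes. -/
theorem reverse_cauchy_schwarz_multipartite {ι κ : Type*} [Fintype ι] (c : ι → κ) (a b : ι → ℝ)
    (hb : ∀ i, 0 ≤ b i) :
    (∑ i, ∑ j, if c i = c j then 0 else a i * a j) * (∑ i, ∑ j, if c i = c j then 0 else b i * b j)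
      ≤ (∑ i, ∑ j, if c i = c j then 0 else a i * b j) ^ 2 := by
  set K := Finset.univ.image c
  set part : (ι → ℝ) → κ → ℝ := fun a C => ∑ i, if c i = C then a i else 0 with hpart
  have hq : ∀ a b : ι → ℝ, (∑ i, ∑ j, if c i = c j then 0 else a i * b j) =
      (∑ i, a i) * (∑ i, b i) - ∑ C ∈ K, part a C * part b C := by
    intro a b
    have h1 : ∑ C ∈ K, part a C * part b C = ∑ i, ∑ j, if c i = c j then a i * b j else 0 := by
      simp only [hpart, Finset.sum_mul_sum]
      rw [Finset.sum_comm]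
      refine Finset.sum_congr rfl fun i _ => ?_
      rw [Finset.sum_comm]
      refine Finset.sum_congr rfl fun j _ => ?_
      rw [Finset.sum_eq_single_of_mem (c i) (Finset.mem_image_of_mem c (Finset.mem_univ i))]
      · simp only [eq_comm (a := c j)]
        split_ifs <;> simp_all
      · intro C _ hC
        simp [Ne.symm hC]
    rw [h1, Finset.sum_mul_sum, ← Finset.sum_sub_distrib]
    refine Finset.sum_congr rfl fun i _ => ?_
    rw [← Finset.sum_sub_distrib]
    refine Finset.sum_congr rfl fun j _ => ?_
    split_ifs <;> ring
  have hbb : 0 ≤ ∑ i, ∑ j, if c i = c j then 0 else b i * b j :=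
    Finset.sum_nonneg fun i _ => Finset.sum_nonneg fun j _ => by
      split_ifs
      · exact le_rfl
      · exact mul_nonneg (hb i) (hb j)
  rcases le_or_gt (∑ i, ∑ j, if c i = c j then 0 else a i * a j) 0 with h0 | h0
  · exact (mul_nonpos_of_nonpos_of_nonneg h0 hbb).trans (sq_nonneg _)
  rw [hq] at hbb h0
  rw [hq, hq, hq]
  have e : ∀ a : ι → ℝ, ∑ C ∈ K, part a C * part a C = ∑ C ∈ K, part a C ^ 2 := fun a =>
    Finset.sum_congr rfl fun C _ => (sq _).symm
  rw [e] at hbb h0 ⊢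
  rw [e, ← sq, ← sq]
  exact aczel_inequality (by nlinarith) (by nlinarith)
    (Finset.sum_nonneg fun _ _ => sq_nonneg _) (Finset.sum_nonneg fun _ _ => sq_nonneg _)
    (Finset.sum_mul_sq_le_sq_mul_sq _ _ _)

variable {E : Type*}

/-- The matrix of coefficients of the quadratic part of a multiaffine polynomial. -/
def pairMat (η : Finset E → ℝ) : Matrix E E ℝ := fun i j => if i = j then 0 else η {i, j}

/-- The indicator function of the bases of a matroid. -/
def baseInd (M : Matroid E) : Finset E → ℝ := fun S => if M.IsBase (S : Set E) then 1 else 0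

theorem baseInd_nonneg (M : Matroid E) (S : Finset E) : 0 ≤ baseInd M S := by
  unfold baseInd; split_ifs <;> norm_num

theorem baseInd_ne_zero {M : Matroid E} {S : Finset E} :
    baseInd M S ≠ 0 ↔ M.IsBase (S : Set E) := by
  unfold baseInd; split_ifs <;> simp_all

theorem exists_isHomog_baseInd (M : Matroid E) : ∃ d, IsHomog d (baseInd M) := by
  obtain ⟨B, hB⟩ := M.exists_isBase
  refine ⟨B.ncard, fun S hS => ?_⟩
  rw [← (baseInd_ne_zero.1 hS).ncard_eq_ncard_of_isBase hB, Set.ncard_coe_finset]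

variable [Fintype E]

theorem lnk_lnk_empty (x y : E → ℝ) (η : Finset E → ℝ) :
    lnk x (lnk y η) ∅ = x ⬝ᵥ pairMat η *ᵥ y := by
  simp only [lnk, dotProduct, mulVec, pairMat]
  refine Finset.sum_congr rfl fun i _ => ?_
  simp only [Finset.notMem_empty, if_false, insert_empty_eq, Finset.mem_singleton]
  congr 1
  refine Finset.sum_congr rfl fun j _ => ?_
  by_cases h : i = j
  · simp [h]
  · rw [if_neg h, if_neg (Ne.symm h), Finset.pair_comm, mul_comm]

theorem lnk_single (i : E) (η : Finset E → ℝ) (S : Finset E) :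
    lnk (Pi.single i 1) η S = if i ∈ S then 0 else η (insert i S) := by
  rw [lnk, Finset.sum_eq_single i]
  · simp
  · intro j _ hj
    simp [hj]
  · simp

theorem lnk_single_baseInd {M : Matroid E} {i : E} (hi : M.IsNonloop i) :
    lnk (Pi.single i 1) (baseInd M) = baseInd (M.contract {i}) := by
  funext S
  rw [lnk_single]
  simp only [baseInd, (Matroid.indep_singleton.2 hi).contract_isBase_iff, Finset.coe_insert,
    Set.union_singleton, Set.disjoint_singleton_right, Finset.mem_coe]
  split_ifs <;> simp_all

theorem lnk_single_baseInd_eq_zero {M : Matroid E} {i : E} (hi : ¬ M.IsNonloop i) :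
    lnk (Pi.single i 1) (baseInd M) = 0 := by
  funext S
  rw [lnk_single]
  split_ifs with h
  · rfl
  · by_contra hne
    have := baseInd_ne_zero.1 hne
    exact hi (this.indep.isNonloop_of_mem (by simp))

/-- Adding the elements of `B \ S` one per direction gives a positive contribution, and no other
term is negative. -/
theorem foldr_lnk_pos {L : List (E → ℝ)} (hL : ∀ v ∈ L, ∀ i, 0 < v i) {ν : Finset E → ℝ}
    (hν : ∀ S, 0 ≤ ν S) {S B : Finset E} (hSB : S ⊆ B) (hB : 0 < ν B)
    (hcard : B.card = S.card + L.length) : 0 < L.foldr lnk ν S := by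
  induction L generalizing S with
  | nil =>
    have : S = B := Finset.eq_of_subset_of_card_le hSB (by simp [hcard])
    simpa [this] using hB
  | cons v L ih =>
    have hne : ∃ i ∈ B, i ∉ S := by
      by_contra! h
      have := Finset.card_le_card (show B ⊆ S from h)
      simp at hcard
      omega
    obtain ⟨i, hiB, hiS⟩ := hne
    have hL' : ∀ v ∈ L, ∀ i, 0 < v i := fun u hu => hL u (by simp [hu])
    have h0 := foldr_lnk_nonneg (fun u hu i => (hL' u hu i).le) hν
    have := ih hL' (S := insert i S) (Finset.insert_subset hiB hSB) (by
      rw [Finset.card_insert_of_notMem hiS, hcard, List.length_cons]; omega)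
    refine Finset.sum_pos' (fun j _ => ?_) ⟨i, Finset.mem_univ i, ?_⟩
    · split_ifs
      · exact le_rfl
      · exact mul_nonneg (hL v (by simp) j).le (h0 _)
    · rw [if_neg hiS]
      exact mul_pos (hL v (by simp) i) this

theorem exists_superset_of_foldr_lnk_ne_zero {L : List (E → ℝ)} {ν : Finset E → ℝ} {S : Finset E}
    (h : L.foldr lnk ν S ≠ 0) : ∃ B, S ⊆ B ∧ ν B ≠ 0 := by
  induction L generalizing S with
  | nil => exact ⟨S, subset_rfl, h⟩
  | cons v L ih =>
    obtain ⟨i, -, hi⟩ := Finset.exists_ne_zero_of_sum_ne_zero h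
    split_ifs at hi with hiS
    · exact absurd rfl hi
    · obtain ⟨B, hB, hB'⟩ := ih (right_ne_zero_of_mul hi)
      exact ⟨B, (Finset.subset_insert i S).trans hB, hB'⟩

/-- Parallelism is an equivalence relation on nonloops, and two nonloops form a basis exactly when
they are not parallel. Taking closures as colours gives the multipartite form; the weights `nl`
remove loops. -/
theorem reverse_cauchy_schwarz_rank_two {M : Matroid E} (hM : IsHomog 2 (baseInd M)) (x : E → ℝ)
    {y : E → ℝ} (hy : ∀ i, 0 < y i) :
    (x ⬝ᵥ pairMat (baseInd M) *ᵥ x) * (y ⬝ᵥ pairMat (baseInd M) *ᵥ y) ≤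
      (x ⬝ᵥ pairMat (baseInd M) *ᵥ y) ^ 2 := by
  set nl : E → ℝ := fun i => if M.IsNonloop i then 1 else 0 with hnl
  have hbase : ∀ i j, i ≠ j → (M.IsBase (({i, j} : Finset E) : Set E) ↔ M.Indep {i, j}) := by
    intro i j hij
    refine ⟨fun h => by simpa using h.indep, fun h => ?_⟩
    obtain ⟨B, hB, hsub⟩ := h.exists_isBase_superset
    have hBf : ((B.toFinite.toFinset : Finset E) : Set E) = B := by simp
    have hc := hM B.toFinite.toFinset (baseInd_ne_zero.2 (by rwa [hBf]))
    have : ({i, j} : Finset E) = B.toFinite.toFinset := by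
      refine Finset.eq_of_subset_of_card_le ?_ (by rw [hc, Finset.card_pair hij])
      intro k hk
      rw [Set.Finite.mem_toFinset]
      exact hsub (by simpa using hk)
    rwa [this, hBf]
  have hentry : ∀ i j, pairMat (baseInd M) i j =
      if M.closure {i} = M.closure {j} then 0 else nl i * nl j := by
    intro i j
    by_cases hij : i = j
    · simp [hij, pairMat]
    simp only [pairMat, if_neg hij, baseInd, hbase i j hij, hnl]
    by_cases hi : M.IsNonloop i
    · by_cases hj : M.IsNonloop j
      · have := hi.closure_eq_closure_iff_eq_or_dep hj
        simp only [hij, false_or] at this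
        by_cases h : M.Indep {i, j} <;> simp [this, h, hi, hj]
      · have : ¬ M.Indep {i, j} := fun h => hj (h.isNonloop_of_mem (by simp))
        simp [this, hj]
    · have : ¬ M.Indep {i, j} := fun h => hi (h.isNonloop_of_mem (by simp))
      simp [this, hi]
  have hform : ∀ x y : E → ℝ, x ⬝ᵥ pairMat (baseInd M) *ᵥ y =
      ∑ i, ∑ j, if M.closure {i} = M.closure {j} then 0 else (nl i * x i) * (nl j * y j) := by
    intro x y
    simp only [dotProduct, mulVec, Finset.mul_sum, hentry]
    refine Finset.sum_congr rfl fun i _ => Finset.sum_congr rfl fun j _ => ?_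
    split_ifs <;> ring
  rw [hform, hform, hform]
  exact reverse_cauchy_schwarz_multipartite (fun i => M.closure {i}) (fun i => nl i * x i)
    (fun i => nl i * y i) fun i => mul_nonneg (by simp only [hnl]; split_ifs <;> norm_num) (hy i).le

/-- The Alexandrov-Fenchel inequality for the basis generating polynomial of a matroid. -/
theorem alexandrov_fenchel_baseInd (L : List (E → ℝ)) (hL : ∀ v ∈ L, ∀ i, 0 < v i)
    {M : Matroid E} (hM : IsHomog (L.length + 2) (baseInd M)) (x : E → ℝ)
    {y : E → ℝ} (hy : ∀ i, 0 < y i) :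
    (x ⬝ᵥ pairMat (L.foldr lnk (baseInd M)) *ᵥ x) * (y ⬝ᵥ pairMat (L.foldr lnk (baseInd M)) *ᵥ y) ≤
      (x ⬝ᵥ pairMat (L.foldr lnk (baseInd M)) *ᵥ y) ^ 2 := by
  induction L generalizing M x y with
  | nil => exact reverse_cauchy_schwarz_rank_two hM x hy
  | cons z L ih =>
    have hz : ∀ i, 0 < z i := hL z (by simp)
    have hL' : ∀ v ∈ L, ∀ i, 0 < v i := fun v hv => hL v (by simp [hv])
    set η := L.foldr lnk (baseInd M) with hη
    have hη0 : ∀ S, 0 ≤ η S := foldr_lnk_nonneg (fun u hu i => (hL' u hu i).le) (baseInd_nonneg M)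
    have hT : ∀ i j k, pairMat (lnk (Pi.single i 1) η) j k =
        if j = k ∨ i = j ∨ i = k then 0 else η {i, j, k} := by
      intro i j k
      simp only [pairMat, lnk_single, Finset.mem_insert, Finset.mem_singleton]
      split_ifs <;> simp_all
    -- Differentiating in a nonloop `i` contracts it, so the induction hypothesis applies; otherwise
    -- the slice vanishes. The test vector is the removed direction `z`.
    have hcontract : ∀ i x, (x ⬝ᵥ pairMat (lnk (Pi.single i 1) η) *ᵥ x) *
        (z ⬝ᵥ pairMat (lnk (Pi.single i 1) η) *ᵥ z) ≤
          (x ⬝ᵥ pairMat (lnk (Pi.single i 1) η) *ᵥ z) ^ 2 := by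
      intro i x
      rw [hη, lnk_foldr]
      by_cases hi : M.IsNonloop i
      · have := IsHomog.lnk (d := L.length + 2) (by convert hM using 1; simp) (Pi.single i 1)
        rw [lnk_single_baseInd hi] at this ⊢
        exact ih hL' this x hz
      · rw [lnk_single_baseInd_eq_zero hi, foldr_lnk_zero]
        have : pairMat (0 : Finset E → ℝ) = 0 := by ext i j; simp [pairMat]
        simp [this]
    have hpos : ∀ i j, i ≠ j → M.Indep {i, j} → 0 < pairMat (lnk z η) i j := by
      intro i j hij hI
      obtain ⟨B, hB, hsub⟩ := hI.exists_isBase_superset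
      have hBf : ((B.toFinite.toFinset : Finset E) : Set E) = B := by simp
      have hBne : baseInd M B.toFinite.toFinset ≠ 0 := baseInd_ne_zero.2 (by rwa [hBf])
      simp only [pairMat, if_neg hij]
      refine foldr_lnk_pos (L := z :: L) hL (baseInd_nonneg M) (B := B.toFinite.toFinset) ?_
        (lt_of_le_of_ne (baseInd_nonneg M _) hBne.symm) ?_
      · intro k hk
        rw [Set.Finite.mem_toFinset]
        exact hsub (by simpa using hk)
      · rw [hM _ hBne, Finset.card_pair hij, add_comm]
    have hnonloop : ∀ i, (∃ k, 0 < pairMat (lnk z η) i k) → M.IsNonloop i := by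
      rintro i ⟨k, hk⟩
      have hik : i ≠ k := by rintro rfl; simp [pairMat] at hk
      simp only [pairMat, if_neg hik] at hk
      obtain ⟨B, hB, hB'⟩ := exists_superset_of_foldr_lnk_ne_zero (L := z :: L) hk.ne'
      exact (baseInd_ne_zero.1 hB').indep.isNonloop_of_mem (hB (by simp))
    refine reverse_cauchy_schwarz_of_slices (T := fun i => pairMat (lnk (Pi.single i 1) η))
      (z := z) ?_ ?_ ?_ hz hcontract (A := pairMat (lnk z η)) ?_ ?_ x hy
    · intro i j k
      rw [hT, hT, Finset.insert_comm]
      refine if_congr ?_ rfl rfl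
      rw [eq_comm (a := i) (b := j)]
      tauto
    · intro i j k
      rw [hT, hT, Finset.pair_comm]
      refine if_congr ?_ rfl rfl
      rw [eq_comm (a := j) (b := k)]
      tauto
    · intro i j k
      rw [hT]
      split_ifs
      · exact le_rfl
      · exact hη0 _
    · intro j k
      by_cases hjk : j = k
      · simp [pairMat, hjk]
      · simp only [pairMat, if_neg hjk, lnk_single]
        exact Finset.sum_congr rfl fun i _ => by split_ifs <;> simp
    -- Connectivity: independent pairs are adjacent. Parallel `i` and `j` share a neighbour, namely
    -- another element `k` of a basis through `i`, which is parallel to neither.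
    · intro c hc i j hi hj
      by_cases hij : i = j
      · rw [hij]
      have hi := hnonloop i hi
      have hj := hnonloop j hj
      by_cases hI : M.Indep {i, j}
      · exact hc i j (hpos i j hij hI)
      obtain ⟨B, hB, hiB⟩ := hi.exists_mem_isBase
      have hBf : ((B.toFinite.toFinset : Finset E) : Set E) = B := by simp
      have hcard := hM B.toFinite.toFinset (baseInd_ne_zero.2 (by rwa [hBf]))
      obtain ⟨k, hkB, hki⟩ := Finset.exists_mem_ne (s := B.toFinite.toFinset) (by omega) i
      rw [Set.Finite.mem_toFinset] at hkB
      have hk : M.IsNonloop k := hB.indep.isNonloop_of_mem hkB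
      have hik : M.Indep {i, k} := hB.indep.subset (by
        intro l hl
        rcases hl with rfl | rfl <;> assumption)
      have hcl : M.closure {i} = M.closure {j} :=
        (hi.closure_eq_closure_iff_eq_or_dep hj).2 (Or.inr hI)
      have hne : ¬ (j = k ∨ ¬ M.Indep {j, k}) := by
        rw [← hj.closure_eq_closure_iff_eq_or_dep hk, ← hcl,
          hi.closure_eq_closure_iff_eq_or_dep hk]
        push Not
        exact ⟨hki.symm, hik⟩
      push Not at hne
      exact (hc i k (hpos i k hki.symm hik)).trans (hc j k (hpos j k hne.1 hne.2)).symm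

end MatroidBases

/-! ### The Hessian inequality for matroids and its passage to limits. -/

section Closure

open Filter Topology

variable {E : Type*} [Fintype E]

theorem continuous_lnk : Continuous fun q : (E → ℝ) × (Finset E → ℝ) => lnk q.1 q.2 := by
  refine continuous_pi fun S => continuous_finsetSum _ fun i _ => ?_
  split_ifs <;> fun_prop

theorem continuous_evalGen (z : E → ℝ) : Continuous (evalGen z) := by
  unfold evalGen
  fun_prop

theorem continuous_foldr_lnk (L : List (E → ℝ)) : Continuous fun ν => L.foldr lnk ν := by
  induction L with
  | nil => exact continuous_id
  | cons v L ih => exact continuous_lnk.comp (continuous_const.prodMk ih)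

theorem continuous_foldr_lnk_add_const (L : List (E → ℝ)) (ν : Finset E → ℝ) :
    Continuous fun ε : ℝ => (L.map fun v i => v i + ε).foldr lnk ν := by
  induction L with
  | nil => exact continuous_const
  | cons v L ih =>
    exact continuous_lnk.comp ((show Continuous fun (ε : ℝ) (i : E) => v i + ε by fun_prop).prodMk ih)

/-- The Hessian inequality is a closed condition. -/
theorem hessian_inequality_of_tendsto {ι : Type*} {l : Filter ι} [l.NeBot]
    {f : ι → Finset E → ℝ} {η : Finset E → ℝ} (hf : Tendsto f l (𝓝 η)) {z u : E → ℝ}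
    (h : ∀ᶠ m in l, evalGen z (f m) * evalGen z (lnk u (lnk u (f m))) ≤
      evalGen z (lnk u (f m)) ^ 2) :
    evalGen z η * evalGen z (lnk u (lnk u η)) ≤ evalGen z (lnk u η) ^ 2 := by
  have hu : Continuous (lnk u) := continuous_lnk.comp (continuous_const.prodMk continuous_id)
  have he := continuous_evalGen z
  exact le_of_tendsto_of_tendsto
    ((he.mul (he.comp (hu.comp hu))).continuousAt.tendsto.comp hf)
    (((he.comp hu).pow 2).continuousAt.tendsto.comp hf) h

theorem HessianBound.of_tendsto {f : ℕ → Finset E → ℝ} {ν : Finset E → ℝ}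
    (hf : Tendsto f atTop (𝓝 ν)) (h : ∀ m, HessianBound (f m)) : HessianBound ν :=
  fun L hL z hz u => hessian_inequality_of_tendsto
    ((continuous_foldr_lnk L).continuousAt.tendsto.comp hf)
    (Eventually.of_forall fun m => h m L hL z hz u)

/-- Shift every direction by `ε > 0` and let `ε → 0`. Strict positivity is what makes the graph in
the matroid argument connected. -/
theorem hessianBound_of_pos {ν : Finset E → ℝ}
    (h : ∀ L : List (E → ℝ), (∀ v ∈ L, ∀ i, 0 < v i) → ∀ z : E → ℝ, (∀ i, 0 < z i) → ∀ u : E → ℝ,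
      evalGen z (L.foldr lnk ν) * evalGen z (lnk u (lnk u (L.foldr lnk ν))) ≤
        evalGen z (lnk u (L.foldr lnk ν)) ^ 2) : HessianBound ν := by
  intro L hL z hz u
  have ht : Tendsto (fun ε : ℝ => (L.map fun v i => v i + ε).foldr lnk ν) (𝓝[>] 0)
      (𝓝 (L.foldr lnk ν)) := by
    have := (continuous_foldr_lnk_add_const L ν).tendsto 0
    simp only [add_zero, List.map_id'] at this
    exact this.mono_left nhdsWithin_le_nhds
  refine hessian_inequality_of_tendsto ht ?_
  filter_upwards [self_mem_nhdsWithin] with ε hε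
  refine h _ ?_ z hz u
  intro v hv i
  obtain ⟨w, hw, rfl⟩ := List.mem_map.1 hv
  exact add_pos_of_nonneg_of_pos (hL w hw i) hε

theorem evalGen_zero (z : E → ℝ) : evalGen z (0 : Finset E → ℝ) = 0 := by
  simp [evalGen]

theorem hessianBound_baseInd (M : Matroid E) : HessianBound (baseInd M) := by
  refine hessianBound_of_pos fun L hL z hz u => ?_
  obtain ⟨d, hd⟩ := exists_isHomog_baseInd M
  rcases lt_or_ge d L.length with hlt | hle
  · rw [hd.foldr_lnk_eq_zero L hlt]
    simp [lnk_zero, evalGen_zero]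
  obtain ⟨m, rfl⟩ := Nat.exists_eq_add_of_le hle
  have hη := hd.foldr_lnk L m
  set η := L.foldr lnk (baseInd M) with hηdef
  match m, hd, hη with
  | 0, _, hη =>
    rw [hη.lnk_eq_zero]
    simp [lnk_zero, evalGen_zero]
  | 1, _, hη =>
    rw [(IsHomog.lnk (d := 0) hη u).lnk_eq_zero, evalGen_zero, mul_zero]
    exact sq_nonneg _
  | e + 2, hd, hη =>
    have h1 : ∀ x : E → ℝ, IsHomog (e + 1) (lnk x η) := fun x => IsHomog.lnk hη x
    have h2 : ∀ x y : E → ℝ, IsHomog e (lnk x (lnk y η)) := fun x y => (h1 y).lnk x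
    -- Appending `e` copies of `z` lowers the degree to exactly two; the resulting constants are
    -- values at `z` up to the factor `e!`.
    have hAF := alexandrov_fenchel_baseInd (List.replicate e z ++ L) (by
      intro v hv
      rcases List.mem_append.1 hv with hv | hv
      · rw [List.eq_of_mem_replicate hv]; exact hz
      · exact hL v hv) (M := M) (by
        convert hd using 1
        simp only [List.length_append, List.length_replicate]
        omega) u hz
    have hval : ∀ x y : E → ℝ, lnk x (lnk y ((List.replicate e z ++ L).foldr lnk (baseInd M))) ∅ =
        e.factorial * evalGen z (lnk x (lnk y η)) := fun x y => by
      rw [List.foldr_append, lnk_foldr, lnk_foldr, (h2 x y).foldr_replicate]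
    simp only [← lnk_lnk_empty, hval] at hAF
    rw [lnk_comm u z, (h1 u).evalGen_lnk_self, (h1 z).evalGen_lnk_self, hη.evalGen_lnk_self] at hAF
    set a := evalGen z (lnk u (lnk u η))
    set b := evalGen z (lnk u η)
    set g := evalGen z η
    have hg : 0 ≤ g := evalGen_nonneg hz
      (foldr_lnk_nonneg (fun v hv i => (hL v hv i).le) (baseInd_nonneg M))
    have hf : (0 : ℝ) < e.factorial := by exact_mod_cast e.factorial_pos
    push_cast at hAF
    have he : (0 : ℝ) ≤ e := e.cast_nonneg
    -- The Euler factors are `(e + 1)(e + 2)` for `g` and `e + 1` for `b`. The outcome is sharper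
    -- than log-concavity.
    have h3 : (e + 2 : ℝ) * (g * a) ≤ (e + 1) * b ^ 2 := by
      have hc : (0 : ℝ) < e.factorial ^ 2 * (e + 1) := by positivity
      refine le_of_mul_le_mul_left ?_ hc
      nlinarith [hAF]
    rcases le_or_gt (g * a) 0 with h0 | h0
    · exact h0.trans (sq_nonneg b)
    · nlinarith

/-! ### Invariance under scalars and external fields, and duality. -/

theorem lnk_smul (c : ℝ) (v : E → ℝ) (ν : Finset E → ℝ) : lnk v (c • ν) = c • lnk v ν := by
  funext S
  simp only [lnk, Pi.smul_apply, smul_eq_mul, Finset.mul_sum]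
  exact Finset.sum_congr rfl fun i _ => by split_ifs <;> ring

theorem foldr_lnk_smul (c : ℝ) (L : List (E → ℝ)) (ν : Finset E → ℝ) :
    L.foldr lnk (c • ν) = c • L.foldr lnk ν := by
  induction L with
  | nil => rfl
  | cons v L ih => simp only [List.foldr_cons, ih, lnk_smul]

theorem evalGen_smul (c : ℝ) (z : E → ℝ) (ν : Finset E → ℝ) :
    evalGen z (c • ν) = c * evalGen z ν := by
  simp only [evalGen, Pi.smul_apply, smul_eq_mul, Finset.mul_sum, mul_assoc]

theorem HessianBound.smul {ν : Finset E → ℝ} (h : HessianBound ν) (c : ℝ) :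
    HessianBound (c • ν) := by
  intro L hL z hz u
  simp only [foldr_lnk_smul, lnk_smul, evalGen_smul]
  nlinarith [mul_le_mul_of_nonneg_left (h L hL z hz u) (sq_nonneg c)]

/-- The unnormalized external field. -/
def scaleField (lam : E → ℝ) (ν : Finset E → ℝ) : Finset E → ℝ := fun S => (∏ i ∈ S, lam i) * ν S

/-- The chain rule for the substitution `z ↦ lam * z`. -/
theorem lnk_scaleField (lam v : E → ℝ) (ν : Finset E → ℝ) :
    lnk v (scaleField lam ν) = scaleField lam (lnk (lam * v) ν) := by
  funext S
  simp only [lnk, scaleField, Finset.mul_sum]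
  refine Finset.sum_congr rfl fun i _ => ?_
  split_ifs with h
  · simp
  · rw [Finset.prod_insert h, Pi.mul_apply]; ring

theorem foldr_lnk_scaleField (lam : E → ℝ) (L : List (E → ℝ)) (ν : Finset E → ℝ) :
    L.foldr lnk (scaleField lam ν) = scaleField lam ((L.map (lam * ·)).foldr lnk ν) := by
  induction L with
  | nil => rfl
  | cons v L ih => simp only [List.foldr_cons, List.map_cons, ih, lnk_scaleField]

theorem evalGen_scaleField (lam z : E → ℝ) (ν : Finset E → ℝ) :
    evalGen z (scaleField lam ν) = evalGen (lam * z) ν := by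
  simp only [evalGen, scaleField, Pi.mul_apply, Finset.prod_mul_distrib]
  exact Finset.sum_congr rfl fun S _ => by ring

theorem HessianBound.scaleField {ν : Finset E → ℝ} (h : HessianBound ν) {lam : E → ℝ}
    (hlam : ∀ i, 0 < lam i) : HessianBound (scaleField lam ν) := by
  intro L hL z hz u
  simp only [foldr_lnk_scaleField, lnk_scaleField, evalGen_scaleField]
  refine h _ ?_ _ (fun i => mul_pos (hlam i) (hz i)) _
  intro v hv i
  obtain ⟨w, hw, rfl⟩ := List.mem_map.1 hv
  exact mul_nonneg (hlam i).le (hL w hw i)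

theorem HessianBound.extField {ν : Finset E → ℝ} (h : HessianBound ν) {lam : E → ℝ}
    (hlam : ∀ i, 0 < lam i) : HessianBound (extField lam ν) := by
  have : _root_.extField lam ν = (∑ T, (∏ i ∈ T, lam i) * ν T)⁻¹ • _root_.scaleField lam ν := by
    funext S
    simp only [_root_.extField, _root_.scaleField, Pi.smul_apply, smul_eq_mul]
    rw [div_eq_inv_mul]
  rw [this]
  exact (h.scaleField hlam).smul _

theorem HessianBound.of_isLimitOfExtFields {ν μ : Finset E → ℝ} (h : HessianBound μ)
    (hν : IsLimitOfExtFields ν μ) : HessianBound ν := by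
  obtain ⟨lam, hlam, hlim⟩ := hν
  exact HessianBound.of_tendsto hlim fun m => h.extField (hlam m)

theorem uniformBases_eq_smul (M : Matroid E) : uniformBases M =
    (1 / (Finset.card {B : Finset E | M.IsBase (B : Set E)} : ℝ)) • baseInd M := by
  funext S
  simp only [uniformBases, baseInd, Pi.smul_apply, smul_eq_mul]
  split_ifs <;> simp

theorem dualDist_baseInd {M : Matroid E} (hE : M.E = Set.univ) :
    dualDist (baseInd M) = baseInd M✶ := by
  funext S
  simp only [dualDist, baseInd, Matroid.dual_isBase_iff', hE]
  simp [Set.compl_eq_univ_sdiff]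

theorem hessianBound_uniformBases (M : Matroid E) : HessianBound (uniformBases M) := by
  rw [uniformBases_eq_smul]
  exact (hessianBound_baseInd M).smul _

theorem hessianBound_dualDist_uniformBases {M : Matroid E} (hE : M.E = Set.univ) :
    HessianBound (dualDist (uniformBases M)) := by
  rw [uniformBases_eq_smul]
  have : ∀ c : ℝ, dualDist (c • baseInd M) = c • baseInd M✶ := fun c => by
    rw [← dualDist_baseInd hE]; rfl
  rw [this]
  exact (hessianBound_baseInd M✶).smul _

theorem sum_dualDist (μ : Finset E → ℝ) : ∑ S, dualDist μ S = ∑ S, μ S :=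
  Fintype.sum_equiv (Function.Involutive.toPerm _ compl_involutive) _ _ fun _ => rfl

/-- The product of the inverse weights over `S` is the product of the weights over `Sᶜ` divided by
the full product; that constant disappears on normalization. -/
theorem scaleField_inv_dualDist {lam : E → ℝ} (hlam : ∀ i, 0 < lam i) (μ : Finset E → ℝ) :
    scaleField lam⁻¹ (dualDist μ) = (∏ i, lam i)⁻¹ • dualDist (scaleField lam μ) := by
  funext S
  simp only [scaleField, dualDist, Pi.inv_apply, Pi.smul_apply, smul_eq_mul,
    Finset.prod_inv_distrib]
  rw [← Finset.prod_mul_prod_compl S lam]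
  have h1 := (Finset.prod_pos fun i (_ : i ∈ S) => hlam i).ne'
  have h2 := (Finset.prod_pos fun i (_ : i ∈ Sᶜ) => hlam i).ne'
  field_simp

theorem extField_inv_dualDist {lam : E → ℝ} (hlam : ∀ i, 0 < lam i) (μ : Finset E → ℝ) :
    extField lam⁻¹ (dualDist μ) = dualDist (extField lam μ) := by
  have hc := (Finset.prod_pos fun i (_ : i ∈ Finset.univ) => hlam i).ne'
  have h : ∀ S, scaleField lam⁻¹ (dualDist μ) S =
      (∏ i, lam i)⁻¹ * dualDist (scaleField lam μ) S := fun S => by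
    rw [scaleField_inv_dualDist hlam]; rfl
  funext S
  change scaleField lam⁻¹ (dualDist μ) S / ∑ T, scaleField lam⁻¹ (dualDist μ) T =
    dualDist (scaleField lam μ) S / ∑ T, scaleField lam μ T
  simp only [h]
  rw [← Finset.mul_sum, sum_dualDist, mul_div_mul_left _ _ (inv_ne_zero hc)]

theorem IsLimitOfExtFields.dualDist {ν μ : Finset E → ℝ} (h : IsLimitOfExtFields ν μ) :
    IsLimitOfExtFields (dualDist ν) (dualDist μ) := by
  obtain ⟨lam, hlam, hlim⟩ := h
  refine ⟨fun m => (lam m)⁻¹, fun m i => inv_pos.2 (hlam m i), ?_⟩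
  simp only [extField_inv_dualDist (hlam _)]
  rw [tendsto_pi_nhds] at hlim ⊢
  exact fun S => hlim _

end Closure

/-! ### Prescribing marginals by entropy duality. -/

section MaximumEntropy

open Filter Topology

variable {E : Type*} [Fintype E]

/-- The partition function of the external field with weights `exp (y i)`. -/
def partFun (μ : Finset E → ℝ) (y : E → ℝ) : ℝ := ∑ S, μ S * Real.exp (∑ i ∈ S, y i)

theorem IsDistribution.exists_pos {μ : Finset E → ℝ} (hμ : IsDistribution μ) : ∃ S, 0 < μ S := by
  by_contra! h
  have := Finset.sum_nonpos fun S (_ : S ∈ Finset.univ) => h S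
  linarith [hμ.2]

theorem IsDistribution.partFun_pos {μ : Finset E → ℝ} (hμ : IsDistribution μ) (y : E → ℝ) :
    0 < partFun μ y := by
  obtain ⟨S, hS⟩ := hμ.exists_pos
  exact Finset.sum_pos' (fun S _ => mul_nonneg (hμ.1 S) (Real.exp_pos _).le)
    ⟨S, Finset.mem_univ S, mul_pos hS (Real.exp_pos _)⟩

theorem continuous_partFun (μ : Finset E → ℝ) : Continuous (partFun μ) := by
  unfold partFun
  fun_prop

theorem hasDerivAt_partFun (μ : Finset E → ℝ) (y : E → ℝ) (i : E) :
    HasDerivAt (fun t : ℝ => partFun μ fun j => y j + t * (Pi.single i 1 : E → ℝ) j)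
      (∑ S, if i ∈ S then μ S * Real.exp (∑ j ∈ S, y j) else 0) 0 := by
  unfold partFun
  refine HasDerivAt.fun_sum fun S _ => ?_
  have h1 : HasDerivAt (fun t : ℝ => ∑ j ∈ S, (y j + t * (Pi.single i 1 : E → ℝ) j))
      (∑ j ∈ S, (Pi.single i 1 : E → ℝ) j) 0 := by
    refine HasDerivAt.fun_sum fun j _ => ?_
    simpa using ((hasDerivAt_id (0 : ℝ)).mul_const ((Pi.single i 1 : E → ℝ) j)).const_add (y j)
  refine (h1.exp.const_mul (μ S)).congr_deriv ?_
  simp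

/-- The log-partition function dominates linear functionals on the convex hull of the support. -/
theorem IsDistribution.exists_le_log_partFun {μ : Finset E → ℝ} (hμ : IsDistribution μ) :
    ∃ K, 0 ≤ K ∧ ∀ p ∈ convexHull ℝ {x | ∃ S : Finset E, μ S ≠ 0 ∧ x = indicatorVec S},
      ∀ y : E → ℝ, ∑ i, y i * p i - K ≤ Real.log (partFun μ y) := by
  refine ⟨∑ S, |Real.log (μ S)|, Finset.sum_nonneg fun _ _ => abs_nonneg _, fun p hp y => ?_⟩
  set K := ∑ S, |Real.log (μ S)|
  -- A half-space containing the hull as soon as it contains its vertices; at `indicatorVec S` it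
  -- suffices to keep the single term `S` of the partition function.
  have hconv : Convex ℝ {q : E → ℝ | ∑ i, y i * q i ≤ Real.log (partFun μ y) + K} := by
    refine convex_halfSpace_le (f := fun q : E → ℝ => ∑ i, y i * q i) ⟨?_, ?_⟩ _
    · intro a b
      simp [mul_add, Finset.sum_add_distrib]
    · intro c a
      simp only [Pi.smul_apply, smul_eq_mul, Finset.mul_sum]
      exact Finset.sum_congr rfl fun i _ => by ring
  have := convexHull_min (t := {q : E → ℝ | ∑ i, y i * q i ≤ Real.log (partFun μ y) + K})
    ?_ hconv hp
  · have : ∑ i, y i * p i ≤ Real.log (partFun μ y) + K := this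
    linarith
  rintro x ⟨S, hS, rfl⟩
  have hS' : 0 < μ S := lt_of_le_of_ne (hμ.1 S) hS.symm
  have h1 : μ S * Real.exp (∑ i ∈ S, y i) ≤ partFun μ y :=
    Finset.single_le_sum (f := fun S => μ S * Real.exp (∑ i ∈ S, y i))
      (fun T _ => mul_nonneg (hμ.1 T) (Real.exp_pos _).le) (Finset.mem_univ S)
  have h2 := Real.log_le_log (mul_pos hS' (Real.exp_pos _)) h1
  rw [Real.log_mul hS (Real.exp_pos _).ne', Real.log_exp] at h2
  have h3 : |Real.log (μ S)| ≤ K :=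
    Finset.single_le_sum (f := fun S => |Real.log (μ S)|) (fun T _ => abs_nonneg _)
      (Finset.mem_univ S)
  have h4 : ∑ i, y i * indicatorVec S i = ∑ i ∈ S, y i := by
    simp [indicatorVec]
  change ∑ i, y i * indicatorVec S i ≤ _
  rw [h4]
  linarith [neg_abs_le (Real.log (μ S))]

theorem extField_exp (μ : Finset E → ℝ) (y : E → ℝ) (S : Finset E) :
    extField (fun i => Real.exp (y i)) μ S = μ S * Real.exp (∑ i ∈ S, y i) / partFun μ y := by
  simp only [extField, partFun, ← Real.exp_sum]
  simp only [mul_comm]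

/-- A regularized maximum entropy problem: points of the convex hull of the support are
approximated by the marginals of external fields. -/
theorem IsDistribution.exists_extField_marginal_near {μ : Finset E → ℝ} (hμ : IsDistribution μ)
    {p : E → ℝ} (hp : p ∈ convexHull ℝ {x | ∃ S : Finset E, μ S ≠ 0 ∧ x = indicatorVec S})
    {δ : ℝ} (hδ : 0 < δ) :
    ∃ lam : E → ℝ, (∀ i, 0 < lam i) ∧ ∀ i, |marginal (extField lam μ) i - p i| ≤ δ := by
  obtain ⟨K, hK0, hK⟩ := hμ.exists_le_log_partFun
  have hK := hK p hp
  -- Chosen so that `4 ε K ≤ δ²`; the `+ 1` covers `K = 0`.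
  set ε : ℝ := δ ^ 2 / (4 * (K + 1)) with hε
  have hε0 : 0 < ε := by positivity
  have hεK : 4 * (ε * K) ≤ δ ^ 2 := by
    have : 4 * (K + 1) * ε = δ ^ 2 := by rw [hε]; field_simp
    nlinarith
  -- Without the penalty the infimum need not be attained when `p` is on the boundary. With it,
  -- sublevel sets are bounded, and stationarity reads `marginal - p = -2 ε y`.
  set φ : (E → ℝ) → ℝ := fun y => Real.log (partFun μ y) - ∑ i, y i * p i + ε * ∑ i, y i ^ 2
    with hφ
  have hφc : Continuous φ := by
    have := (continuous_partFun μ).log fun y => (hμ.partFun_pos y).ne'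
    fun_prop
  have hφ0 : φ 0 = 0 := by
    simp [hφ, partFun, hμ.2]
  have hbd : ∀ y, φ y ≤ φ 0 → ∀ i, ε * y i ^ 2 ≤ K := by
    intro y hy i
    have h1 := hK y
    have h2 : y i ^ 2 ≤ ∑ i, y i ^ 2 :=
      Finset.single_le_sum (f := fun i => y i ^ 2) (fun _ _ => sq_nonneg _) (Finset.mem_univ i)
    rw [hφ0] at hy
    have hy : Real.log (partFun μ y) - ∑ i, y i * p i + ε * ∑ i, y i ^ 2 ≤ 0 := hy
    nlinarith [mul_le_mul_of_nonneg_left h2 hε0.le]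
  obtain ⟨y, hy⟩ := hφc.exists_forall_le_of_isBounded 0 (by
    refine isBounded_iff_forall_norm_le.2 ⟨√(K / ε), fun y hy => ?_⟩
    refine (pi_norm_le_iff_of_nonneg (Real.sqrt_nonneg _)).2 fun i => ?_
    refine Real.abs_le_sqrt ?_
    rw [le_div_iff₀ hε0]
    linarith [hbd y hy i])
  refine ⟨fun i => Real.exp (y i), fun i => Real.exp_pos _, fun i => ?_⟩
  have hmarg : marginal (extField (fun i => Real.exp (y i)) μ) i =
      (∑ S, if i ∈ S then μ S * Real.exp (∑ j ∈ S, y j) else 0) / partFun μ y := by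
    rw [marginal, Finset.sum_filter, Finset.sum_div]
    refine Finset.sum_congr rfl fun S _ => ?_
    rw [extField_exp]
    split_ifs <;> simp
  have hd1 := (hasDerivAt_partFun μ y i).log (by simpa using (hμ.partFun_pos y).ne')
  have hd2 : HasDerivAt (fun t : ℝ => ∑ j, (y j + t * (Pi.single i 1 : E → ℝ) j) * p j) (p i) 0 := by
    have : HasDerivAt (fun t : ℝ => ∑ j, (y j + t * (Pi.single i 1 : E → ℝ) j) * p j)
        (∑ j, (Pi.single i 1 : E → ℝ) j * p j) 0 := HasDerivAt.fun_sum fun j _ => by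
      simpa using
        (((hasDerivAt_id (0 : ℝ)).mul_const ((Pi.single i 1 : E → ℝ) j)).const_add (y j)).mul_const (p j)
    refine this.congr_deriv ?_
    simp [Pi.single_apply]
  have hd3 : HasDerivAt (fun t : ℝ => ∑ j, (y j + t * (Pi.single i 1 : E → ℝ) j) ^ 2) (2 * y i) 0 := by
    have : HasDerivAt (fun t : ℝ => ∑ j, (y j + t * (Pi.single i 1 : E → ℝ) j) ^ 2)
        (∑ j, 2 * y j * (Pi.single i 1 : E → ℝ) j) 0 := HasDerivAt.fun_sum fun j _ => by
      simpa using
        (((hasDerivAt_id (0 : ℝ)).mul_const ((Pi.single i 1 : E → ℝ) j)).const_add (y j)).fun_pow 2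
    refine this.congr_deriv ?_
    simp [Pi.single_apply]
  have hd := (hd1.sub hd2).add (hd3.const_mul ε)
  have hmin : IsLocalMin (fun t : ℝ => φ fun j => y j + t * (Pi.single i 1 : E → ℝ) j) 0 := by
    refine Eventually.of_forall fun t => ?_
    simpa using hy fun j => y j + t * (Pi.single i 1 : E → ℝ) j
  have hzero := hmin.hasDerivAt_eq_zero hd
  simp only [zero_mul, add_zero] at hzero
  rw [← hmarg] at hzero
  have h1 : marginal (extField (fun i => Real.exp (y i)) μ) i - p i = -(2 * (ε * y i)) := by
    linarith
  rw [h1, abs_neg]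
  refine abs_le_of_sq_le_sq ?_ hδ.le
  -- The squared error is `4 ε² y_i² ≤ 4 ε K ≤ δ²`.
  have h2 := mul_le_mul_of_nonneg_left (hbd y (hy 0) i) hε0.le
  nlinarith

theorem IsDistribution.extField {μ : Finset E → ℝ} (hμ : IsDistribution μ) {lam : E → ℝ}
    (hlam : ∀ i, 0 < lam i) : IsDistribution (extField lam μ) := by
  have h0 : ∀ S, 0 ≤ (∏ i ∈ S, lam i) * μ S := fun S =>
    mul_nonneg (Finset.prod_nonneg fun i _ => (hlam i).le) (hμ.1 S)
  obtain ⟨S, hS⟩ := hμ.exists_pos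
  have hpos : 0 < ∑ T, (∏ i ∈ T, lam i) * μ T := Finset.sum_pos' (fun T _ => h0 T)
    ⟨S, Finset.mem_univ S, mul_pos (Finset.prod_pos fun i _ => hlam i) hS⟩
  refine ⟨fun S => div_nonneg (h0 S) hpos.le, ?_⟩
  simp only [_root_.extField]
  rw [← Finset.sum_div, div_self hpos.ne']

/-- Take fields with marginal error `1 / (m + 1)` and a subsequence converging in the compact
simplex. The weights may diverge, so the limit can lose support but never gain any. -/
theorem IsDistribution.exists_limit_with_marginals {μ : Finset E → ℝ} (hμ : IsDistribution μ)
    {p : E → ℝ} (hp : p ∈ convexHull ℝ {x | ∃ S : Finset E, μ S ≠ 0 ∧ x = indicatorVec S}) :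
    ∃ ν, IsDistribution ν ∧ (∀ S, ν S ≠ 0 → μ S ≠ 0) ∧ (∀ i, marginal ν i = p i) ∧
      IsLimitOfExtFields ν μ := by
  choose lam hlam hmarg using fun m : ℕ =>
    hμ.exists_extField_marginal_near hp (Nat.one_div_pos_of_nat (α := ℝ) (n := m))
  have hmem : ∀ m, _root_.extField (lam m) μ ∈ stdSimplex ℝ (Finset E) := fun m =>
    hμ.extField (hlam m)
  obtain ⟨ν, hν, ψ, hψ, hlim⟩ := (isCompact_stdSimplex ℝ (Finset E)).tendsto_subseq hmem
  have hlimS := tendsto_pi_nhds.1 hlim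
  refine ⟨ν, hν, fun S hS hS' => hS ?_, fun i => ?_, fun m => lam (ψ m), fun m => hlam _, hlim⟩
  · refine tendsto_nhds_unique (hlimS S) ?_
    simp [_root_.extField, hS']
  · have h1 : Tendsto (fun m => marginal (_root_.extField (lam (ψ m)) μ) i) atTop
        (𝓝 (marginal ν i)) := tendsto_finsetSum _ fun S _ => hlimS S
    have h2 : Tendsto (fun m => marginal (_root_.extField (lam (ψ m)) μ) i) atTop (𝓝 (p i)) := by
      rw [tendsto_iff_dist_tendsto_zero]
      exact squeeze_zero (fun _ => dist_nonneg) (fun m => hmarg (ψ m) i)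
        ((tendsto_one_div_add_atTop_nhds_zero_nat (𝕜 := ℝ)).comp hψ.tendsto_atTop)
    exact tendsto_nhds_unique h1 h2

theorem uniformBases_ne_zero {M : Matroid E} {S : Finset E} :
    uniformBases M S ≠ 0 ↔ M.IsBase (S : Set E) := by
  unfold uniformBases
  split_ifs with h
  · simp only [h, iff_true]
    have : 0 < Finset.card {B : Finset E | M.IsBase (B : Set E)} :=
      Finset.card_pos.2 ⟨S, by simpa using h⟩
    positivity
  · simp [h]

theorem isDistribution_uniformBases (M : Matroid E) : IsDistribution (uniformBases M) := by
  refine ⟨fun S => ?_, ?_⟩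
  · unfold uniformBases
    split_ifs <;> positivity
  · obtain ⟨B, hB⟩ := M.exists_isBase
    have : 0 < Finset.card {B : Finset E | M.IsBase (B : Set E)} :=
      Finset.card_pos.2 ⟨B.toFinite.toFinset, by simpa using hB⟩
    have : (Finset.card {B : Finset E | M.IsBase (B : Set E)} : ℝ) ≠ 0 := by positivity
    simp only [uniformBases]
    rw [← Finset.sum_filter, Finset.sum_const, nsmul_eq_mul, mul_one_div_cancel this]

end MaximumEntropy

end

theorem mainTheorem9 (n : ℕ) (M : Matroid (Fin n)) (hE : M.E = Set.univ)
    (p : Fin n → ℝ) (hp : p ∈ basePolytope M) :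
    ∃ ν : Finset (Fin n) → ℝ,
      IsDistribution ν ∧
      (∀ S, ν S ≠ 0 → M.IsBase (S : Set (Fin n))) ∧
      (∀ i, marginal ν i = p i) ∧
      IsCompletelyLogConcave (genPoly ν) ∧
      IsCompletelyLogConcave (genPoly (dualDist ν)) ∧
      IsLimitOfExtFields ν (uniformBases M) ∧
      IsLimitOfExtFields (dualDist ν) (dualDist (uniformBases M)) := by
  obtain ⟨ν, hν, hsupp, hmarg, hlim⟩ :=
    (isDistribution_uniformBases M).exists_limit_with_marginals (p := p) (by
      simp only [uniformBases_ne_zero]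
      exact hp)
  exact ⟨ν, hν, fun S hS => uniformBases_ne_zero.1 (hsupp S hS), hmarg,
    ((hessianBound_uniformBases M).of_isLimitOfExtFields hlim).isCompletelyLogConcave hν.1,
    ((hessianBound_dualDist_uniformBases hE).of_isLimitOfExtFields
      hlim.dualDist).isCompletelyLogConcave fun S => hν.1 _,
    hlim, hlim.dualDist⟩
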